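/- Let $d,s\ge 1$. Consider bond percolation on the nearest-neighbour graph $\mathbb Z^{d}\times\mathbb Z^{s}$ in which, independently, each edge joining two vertices that differ only in their $\mathbb Z^d$-component is open with probability $p\in[0,1]$, and each edge joining two vertices that differ only in their $\mathbb Z^s$-component is open with probability $q\in[0,1]$. Let $\theta(p,q)$ be the probability that the open cluster of the origin is infinite, and let $q_c(p)=q_c^{d,s}(p)=\sup\{q:\theta(p,q)=0\}$. For isotropic bond percolation on $\mathbb Z^d$ with parameter $p$, let $p_c(d)$ be the critical threshold (the supremum of the $p\in[0,1]$ for which the open cluster of the origin is a.s. finite) and let $\chi_d(p)$ be the expected size of the open cluster of the origin. Write $a(p)\approx b(p)$ if $\log a(p)/\log b(p)\to 1$ as $p\uparrow p_c(d)$. We say that $\gamma(d)$ exists and equals $\gamma>0$ if $\chi_d(p)\approx|p-p_c(d)|^{-\gamma}$, and that the crossover exponent (from $\mathbb Z^d$ to $\mathbb Z^{d}\times\mathbb Z^s$) exists and equals $\psi>0$ if $q_c^{d,s}(p)\approx|p-p_c(d)|^{\psi}$; it is written $\psi(d)$. (1) For $d=1$, $\gamma(1)$ exists and equals $1$, and for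 every $s\ge1$ the crossover exponent $\psi(1)$ exists and equals $1$ (both exponents are uniquely determined). Hence the crossover conjecture holds for $d=1$: there is $\psi>0$ such that $q_c^{1,s}(p)\approx|p-p_c(1)|^{\psi}$ for all $s\ge1$, and if $\gamma(1)$ exists, then $\psi=\gamma(1)$. (2) For all $d,s\ge1$: if $\gamma(d)$ exists and the crossover exponent $\psi(d)$ from $\mathbb Z^d$ to $\mathbb Z^d\times\mathbb Z^s$ exists, then $\psi(d)\le\gamma(d)$. -/

import Mathlib

open scoped ENNReal Topology unitInterval

noncomputable section

namespace Percolation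

open MeasureTheory Filter

/-- A bond configuration on the graph `G`: an edge `e` is open if `ω e = true`, and closed
otherwise. It carries the product (cylinder) sigma-algebra. -/
abbrev Config {V : Type*} (G : SimpleGraph V) : Type _ := G.edgeSet → Bool

/-- The law of independent bond percolation on `G` in which the edge `e` is open with
probability `w e`. -/
def bondMeasure {V : Type*} (G : SimpleGraph V) (w : G.edgeSet → I) : Measure (Config G) :=
  Measure.infinitePi fun e => ProbabilityTheory.bernoulliMeasure true false (w e)

/-- The subgraph formed by the open edges of a configuration. -/
def openGraph {V : Type*} (G : SimpleGraph V) (ω : Config G) : SimpleGraph V where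
  Adj x y := ∃ h : G.Adj x y, ω ⟨s(x, y), h⟩ = true
  symm := ⟨by
    rintro x y ⟨h, hω⟩
    refine ⟨h.symm, ?_⟩
    rw [← hω]
    congr 2
    exact Sym2.eq_swap⟩
  loopless := ⟨fun _ h => G.irrefl h.1⟩

/-- The open cluster of the vertex `x`. -/
def cluster {V : Type*} (G : SimpleGraph V) (ω : Config G) (x : V) : Set V :=
  {y | (openGraph G ω).Reachable x y}

/-- The nearest neighbour graph on `ℤ^d`. -/
def lattice (d : ℕ) : SimpleGraph (Fin d → ℤ) where
  Adj x y := ∑ i, |x i - y i| = 1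
  symm := ⟨fun x y h => by simpa only [abs_sub_comm] using h⟩
  loopless := ⟨fun x h => by simp at h⟩

/-- The nearest neighbour graph on `ℤ^(d+s) = ℤ^d × ℤ^s`. -/
abbrev prodLattice (d s : ℕ) : SimpleGraph ((Fin d → ℤ) × (Fin s → ℤ)) :=
  (lattice d).boxProd (lattice s)

/-- An edge of `ℤ^d × ℤ^s` is a `ℤ^d`-edge if its end points have the same `ℤ^s`-component.
All the other edges are `ℤ^s`-edges. -/
def IsBaseEdge {d s : ℕ} (e : (prodLattice d s).edgeSet) : Prop :=
  (Sym2.map Prod.snd e.1).IsDiag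

open Classical in
/-- The anisotropic percolation measure on `ℤ^d × ℤ^s`: each `ℤ^d`-edge is open with probability
`p` and each `ℤ^s`-edge is open with probability `q`, independently. -/
def anisoMeasure (d s : ℕ) (p q : I) : Measure (Config (prodLattice d s)) :=
  bondMeasure (prodLattice d s) fun e => if IsBaseEdge e then p else q

/-- The isotropic percolation measure on `ℤ^d` with parameter `p`. -/
def isoMeasure (d : ℕ) (p : I) : Measure (Config (lattice d)) :=
  bondMeasure (lattice d) fun _ => p

/-- The percolation probability on `ℤ^d × ℤ^s`. -/
def thetaAniso (d s : ℕ) (p q : I) : ℝ≥0∞ :=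
  anisoMeasure d s p q {ω | (cluster (prodLattice d s) ω 0).Infinite}

/-- The percolation probability on `ℤ^d`. -/
def theta (d : ℕ) (p : I) : ℝ≥0∞ :=
  isoMeasure d p {ω | (cluster (lattice d) ω 0).Infinite}

/-- The mean size of the open cluster of the origin on `ℤ^d`, possibly infinite. -/
def chi (d : ℕ) (p : I) : ℝ≥0∞ :=
  ∫⁻ ω, ((cluster (lattice d) ω 0).encard : ℝ≥0∞) ∂(isoMeasure d p)

/-- The critical threshold `p_c(d)` of `ℤ^d`. -/
def pc (d : ℕ) : ℝ := sSup ((fun p : I => (p : ℝ)) '' {p : I | theta d p = 0})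

/-- The critical curve `q_c(p)` of `ℤ^d × ℤ^s`. -/
def qc (d s : ℕ) (p : I) : ℝ := sSup ((fun q : I => (q : ℝ)) '' {q : I | thetaAniso d s p q = 0})

/-- The filter of the limit `p ↑ p_c(d)`, for parameters `p ∈ [0, 1]`. -/
def belowPc (d : ℕ) : Filter I := comap (fun p : I => (p : ℝ)) (𝓝[<] (pc d))

/-- Logarithmic equivalence of nonnegative functions: `log a / log b → 1` along `l`. As
`Real.log 0 = 0`, the limit `1` forces `a` and `b` to be nonzero eventually along `l`. -/
def LogEquiv (l : Filter I) (a b : I → ℝ) : Prop :=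
  Tendsto (fun p => Real.log (a p) / Real.log (b p)) l (𝓝 1)

/-- `γ` is the critical exponent `γ(d)`: it is positive, and `χ_d(p) ≈ |p - p_c(d)|^(-γ)` as
`p ↑ p_c(d)`. Where `χ_d(p) = ∞` the real value is `0`, with logarithm `0`, so that the limit
forces `χ_d(p)` to be finite for `p` close to `p_c(d)` from below. -/
def IsGammaExponent (d : ℕ) (γ : ℝ) : Prop :=
  0 < γ ∧ LogEquiv (belowPc d) (fun p => (chi d p).toReal) (fun p => |(p : ℝ) - pc d| ^ (-γ))

/-- `ψ` is the crossover exponent from `ℤ^d` to `ℤ^d × ℤ^s`: it is positive, and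
`q_c(p) ≈ |p - p_c(d)|^ψ` as `p ↑ p_c(d)`. -/
def IsCrossoverExponent (d s : ℕ) (ψ : ℝ) : Prop :=
  0 < ψ ∧ LogEquiv (belowPc d) (qc d s) (fun p => |(p : ℝ) - pc d| ^ ψ)

/-- The crossover conjecture in dimension `d`: there is a crossover exponent `ψ`, the same for
all `s ≥ 1`, and it is equal to the exponent `γ(d)` if the latter exists. -/
def CrossoverConjecture (d : ℕ) : Prop :=
  ∃ ψ : ℝ, (∀ s : ℕ, 1 ≤ s → IsCrossoverExponent d s ψ) ∧
    ∀ γ : ℝ, IsGammaExponent d γ → ψ = γ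

end Percolation

end

/-! Two bounds on the critical curve carry everything.

Lower bound, for all `d` and `s`: `q_c(p) ≥ 1 / (2 * 3 ^ s * χ_d(p))` when `χ_d(p)` is finite
(`inv_chi_le_qc`). Cut an open walk from `x` at its last exit from the cluster `A` of `x` formed by
`ℤ^d`-edges alone. The exit uses an open `ℤ^s`-edge at a vertex of `A`, and the rest of the walk
avoids `A`. The shape of `A`, the exit edge and the rest depend on disjoint sets of edges, so they
are independent. With `X = χ_d(p)` and at most `3 ^ s` exits per vertex, the expected number `M_n`
of vertices reached in at most `n` steps obeys a bound `M_{n+1} ≤ X + 3 ^ s * q * X * M_n`. If `3 ^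
s * q * X < 1` this stays bounded, so clusters are almost surely finite (`tsum_mem_cluster_le`).
Taking logarithms gives `ψ ≤ γ`.

Upper bound, for `d = 1`: `q_c(p) ≤ 5184 * (1 - p)` (`qc_one_le`). In a quadrant of a plane,
horizontal segments of length `L` of order `1 / q` act as coarse sites. A site is good if its
horizontal edges are all open and some edge leading up is open; when `1 - p` is small compared with
`q`, sites are bad with probability at most `1 / 324`. Instead of a Peierls argument, a 3 by 3
renormalization is used: a block is bad when two of its nine sub-blocks are, so bad probabilities
satisfy `r_{n+1} ≤ 81 * r_n ^ 2`. With positive probability every corner block is good, which makes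
the origin's cluster infinite.

For `d = 1` an elementary bound gives `χ_1(p) ≤ 2 / (1 - p)`, hence `q_c` is of order `1 - p`. The
matching lower bound on `χ_1` follows from the two bounds on `q_c` above, so both exponents are `1`.
-/

noncomputable section

namespace Percolation

open MeasureTheory Filter ProbabilityTheory

/-! ### Product measure: independence over disjoint edge sets. -/

section Graph

variable {V : Type*} {G : SimpleGraph V}

instance instIsProbabilityMeasureBondMeasure (w : G.edgeSet → I) :
    IsProbabilityMeasure (bondMeasure G w) := by
  unfold bondMeasure; infer_instance

instance instIsProbabilityMeasureAnisoMeasure (d s : ℕ) (p q : I) :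
    IsProbabilityMeasure (anisoMeasure d s p q) := by
  unfold anisoMeasure; infer_instance

instance instIsProbabilityMeasureIsoMeasure (d : ℕ) (p : I) :
    IsProbabilityMeasure (isoMeasure d p) := by
  unfold isoMeasure; infer_instance

theorem bondMeasure_open (w : G.edgeSet → I) (e : G.edgeSet) :
    bondMeasure G w {ω | ω e = true} = ENNReal.ofReal (w e) := by
  have h := (measurePreserving_eval_infinitePi
    (fun e => bernoulliMeasure true false (w e)) e).measure_preimage
      (s := {true}) (by measurability)
  have h2 : bondMeasure G w {ω | ω e = true} = bernoulliMeasure true false (w e) {true} := h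
  rw [h2, bernoulliMeasure_apply _ (by measurability)]
  simp
  rw [ENNReal.ofReal, ← ENNReal.coe_inj.2 rfl]
  congr 1
  ext
  simp [(w e).2.1]

theorem measurableSet_open (e : G.edgeSet) : MeasurableSet {ω : Config G | ω e = true} :=
  measurableSet_preimage (measurable_pi_apply (X := fun _ : G.edgeSet => Bool) e)
    (measurableSet_singleton true)

theorem bondMeasure_closed (w : G.edgeSet → I) (e : G.edgeSet) :
    bondMeasure G w {ω | ω e = false} = ENNReal.ofReal (1 - w e) := by
  have h : {ω : Config G | ω e = false} = {ω | ω e = true}ᶜ := by ext; simp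
  rw [h, prob_compl_eq_one_sub (measurableSet_open e), bondMeasure_open, ENNReal.ofReal_sub _ (w e).2.1,
    ENNReal.ofReal_one]

/-- The configuration in which the edges outside `S` are closed. -/
def restrictTo (S : Set G.edgeSet) (ω : Config G) : Config G :=
  open Classical in fun e => if e ∈ S then ω e else false

/-- The sigma-algebra generated by the states of the edges in `S`. -/
abbrev edgeSigma (S : Set G.edgeSet) : MeasurableSpace (Config G) :=
  ⨆ e ∈ S, MeasurableSpace.comap (fun ω : Config G => ω e) inferInstance

theorem edgeSigma_mono {S T : Set G.edgeSet} (h : S ⊆ T) : edgeSigma S ≤ edgeSigma T :=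
  biSup_mono h

theorem edgeSigma_le (S : Set G.edgeSet) :
    edgeSigma S ≤ (inferInstance : MeasurableSpace (Config G)) :=
  iSup₂_le fun e _ => (measurable_pi_apply e).comap_le

theorem measurable_eval_edgeSigma {S : Set G.edgeSet} {e : G.edgeSet} (he : e ∈ S) :
    Measurable[edgeSigma S] fun ω : Config G => ω e :=
  Measurable.of_comap_le
    (le_iSup₂_of_le (f := fun (e : G.edgeSet) (_ : e ∈ S) =>
      MeasurableSpace.comap (fun ω : Config G => ω e) inferInstance) e he le_rfl)

theorem measurable_restrictTo (S : Set G.edgeSet) :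
    Measurable[edgeSigma S] (restrictTo S : Config G → Config G) := by
  refine @measurable_pi_lambda _ _ _ (edgeSigma S) _ _ fun e => ?_
  by_cases he : e ∈ S
  · simpa [restrictTo, he] using measurable_eval_edgeSigma he
  · simp [restrictTo, he]

/-- Locality criterion: an event unchanged by closing all edges outside `S` is its own preimage
under `restrictTo S`. -/
theorem measurableSet_edgeSigma_of_restrictTo {S : Set G.edgeSet} {E : Set (Config G)}
    (hE : MeasurableSet E) (h : ∀ ω, restrictTo S ω ∈ E ↔ ω ∈ E) :
    MeasurableSet[edgeSigma S] E := by
  have : E = restrictTo S ⁻¹' E := by ext ω; exact (h ω).symm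
  rw [this]
  exact measurable_restrictTo S hE

theorem indep_edgeSigma (w : G.edgeSet → I) {S T : Set G.edgeSet} (h : Disjoint S T) :
    Indep (edgeSigma S) (edgeSigma T) (bondMeasure G w) := by
  refine indep_iSup_of_disjoint (fun e => (measurable_pi_apply e).comap_le) ?_ h
  exact (iIndepFun_infinitePi (P := fun e => bernoulliMeasure true false (w e))
    (X := fun _ b => b) fun _ => measurable_id)

theorem bondMeasure_inter (w : G.edgeSet → I) {S T : Set G.edgeSet} (h : Disjoint S T)
    {E F : Set (Config G)} (hE : MeasurableSet[edgeSigma S] E)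
    (hF : MeasurableSet[edgeSigma T] F) :
    bondMeasure G w (E ∩ F) = bondMeasure G w E * bondMeasure G w F :=
  (Indep_iff _ _ _).1 (indep_edgeSigma w h) E F hE hF

theorem measurePreserving_comp_edges {V' : Type*} {G' : SimpleGraph V'} (w : G.edgeSet → I)
    (f : G'.edgeSet → G.edgeSet) (hf : Function.Injective f) :
    MeasurePreserving (fun (ω : Config G) e => ω (f e)) (bondMeasure G w)
      (bondMeasure G' (w ∘ f)) := by
  refine ⟨by fun_prop, ?_⟩
  exact Measure.map_infinitePi_infinitePi_of_inj
    (P := fun e => bernoulliMeasure true false (w e)) hf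

/-! ### Walks of bounded length, last exits, and locality of cluster events. -/

/-- `y` is reached from `x` by an open walk of at most `n` steps that avoids `A`. -/
def Within (H : SimpleGraph V) (A : Set V) : ℕ → V → V → Prop
  | 0, x, y => x = y ∧ x ∉ A
  | n + 1, x, y => Within H A n x y ∨ x ∉ A ∧ ∃ z, H.Adj x z ∧ Within H A n z y

variable {H : SimpleGraph V} {A : Set V} {n : ℕ} {x y : V}

theorem Within.succ (h : Within H A n x y) : Within H A (n + 1) x y := Or.inl h

theorem Within.mono_left {m : ℕ} (hmn : m ≤ n) (h : Within H A m x y) : Within H A n x y := by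
  induction hmn with
  | refl => exact h
  | step _ ih => exact ih.succ

theorem Within.notMem (h : Within H A n x y) : x ∉ A := by
  induction n with
  | zero => exact h.2
  | succ n ih => exact h.elim ih And.left

theorem Within.mono {H' : SimpleGraph V} {A' : Set V} (hA : A' ⊆ A)
    (hH : ∀ u v, u ∉ A → v ∉ A → H.Adj u v → H'.Adj u v) (h : Within H A n x y) :
    Within H' A' n x y := by
  induction n generalizing x with
  | zero => exact ⟨h.1, fun h' => h.2 (hA h')⟩
  | succ n ih =>
    rcases h with h | ⟨hx, z, hz, h⟩
    · exact (ih h).succ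
    · exact Or.inr ⟨fun h' => hx (hA h'), z, hH _ _ hx h.notMem hz, ih h⟩

theorem Within.reachable (h : Within H A n x y) : H.Reachable x y := by
  induction n generalizing x with
  | zero => rw [h.1]
  | succ n ih =>
    rcases h with h | ⟨_, z, hz, h⟩
    · exact ih h
    · exact hz.reachable.trans (ih h)

theorem reachable_iff_exists_within : H.Reachable x y ↔ ∃ n, Within H ∅ n x y := by
  refine ⟨fun h => ?_, fun ⟨n, h⟩ => h.reachable⟩
  obtain ⟨p⟩ := h
  induction p with
  | nil => exact ⟨0, rfl, by simp⟩
  | cons h _ ih =>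
    obtain ⟨n, hn⟩ := ih
    exact ⟨n + 1, Or.inr ⟨by simp, _, h, hn⟩⟩

/-- Decomposition of a walk at its last exit from `K`. -/
theorem Within.last_exit (K : Set V) (h : Within H ∅ n x y) :
    y ∈ K ∨ Within H K n x y ∨ ∃ u ∈ K, ∃ v, H.Adj u v ∧ Within H K (n - 1) v y := by
  induction n generalizing x with
  | zero =>
    by_cases hx : x ∈ K
    · exact Or.inl (h.1 ▸ hx)
    · exact Or.inr (Or.inl ⟨h.1, hx⟩)
  | succ n ih =>
    rcases h with h | ⟨_, z, hz, h⟩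
    · rcases ih h with h | h | ⟨u, hu, v, huv, h⟩
      · exact Or.inl h
      · exact Or.inr (Or.inl h.succ)
      · exact Or.inr (Or.inr ⟨u, hu, v, huv, h.mono_left (by omega)⟩)
    · rcases ih h with h | h | ⟨u, hu, v, huv, h⟩
      · exact Or.inl h
      · by_cases hx : x ∈ K
        · exact Or.inr (Or.inr ⟨x, hx, z, hz, h⟩)
        · exact Or.inr (Or.inl (Or.inr ⟨hx, z, hz, h⟩))
      · exact Or.inr (Or.inr ⟨u, hu, v, huv, h.mono_left (by omega)⟩)

theorem measurableSet_adj (x y : V) : MeasurableSet {ω | (openGraph G ω).Adj x y} := by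
  by_cases h : G.Adj x y
  · have : {ω | (openGraph G ω).Adj x y} = {ω : Config G | ω ⟨s(x, y), h⟩ = true} := by
      ext ω; simp [openGraph, h]
    rw [this]
    exact measurableSet_open _
  · have : {ω | (openGraph G ω).Adj x y} = ∅ := by
      ext ω; simp [openGraph, h]
    rw [this]; exact MeasurableSet.empty

theorem measurableSet_within [Countable V] (A : Set V) (n : ℕ) (x y : V) :
    MeasurableSet {ω | Within (openGraph G ω) A n x y} := by
  induction n generalizing x with
  | zero => exact MeasurableSet.const _
  | succ n ih =>
    have : {ω | Within (openGraph G ω) A (n + 1) x y} =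
        {ω | Within (openGraph G ω) A n x y} ∪ ({_ω | x ∉ A} ∩
          ⋃ z, {ω | (openGraph G ω).Adj x z} ∩ {ω | Within (openGraph G ω) A n z y}) := by
      ext ω; simp [Within]
    rw [this]
    exact (ih x).union ((MeasurableSet.const _).inter
      (.iUnion fun z => (measurableSet_adj x z).inter (ih z)))

theorem measurableSet_mem_cluster [Countable V] (x y : V) :
    MeasurableSet {ω | y ∈ cluster G ω x} := by
  have : {ω | y ∈ cluster G ω x} = ⋃ n, {ω | Within (openGraph G ω) ∅ n x y} := by
    ext ω; simp [cluster, reachable_iff_exists_within]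
  rw [this]
  exact .iUnion fun n => measurableSet_within _ _ _ _

theorem measurableSet_cluster_eq [Countable V] (x : V) (A : Set V) :
    MeasurableSet {ω | cluster G ω x = A} := by
  have : {ω | cluster G ω x = A} = ⋂ y, {ω | y ∈ cluster G ω x ↔ y ∈ A} := by
    ext ω; simp [Set.ext_iff]
  rw [this]
  exact .iInter fun y => (measurableSet_mem_cluster x y).iff (MeasurableSet.const _)

theorem mem_cluster_self (ω : Config G) (x : V) : x ∈ cluster G ω x :=
  SimpleGraph.Reachable.refl x

/-- The edges with an end point in `A`. -/
def touching (G : SimpleGraph V) (A : Set V) : Set G.edgeSet := {e | ∃ v ∈ A, v ∈ e.1}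

theorem openGraph_adj_restrictTo {S : Set G.edgeSet} {ω : Config G} :
    (openGraph G (restrictTo S ω)).Adj x y ↔
      ∃ h : G.Adj x y, (⟨s(x, y), h⟩ : G.edgeSet) ∈ S ∧ ω ⟨s(x, y), h⟩ = true := by
  simp [openGraph, restrictTo]

/-- A walk that avoids `A` crosses no edge touching `A`. -/
theorem within_restrictTo_compl_touching (ω : Config G) (A : Set V) (n : ℕ) (x y : V) :
    Within (openGraph G (restrictTo (touching G A)ᶜ ω)) A n x y ↔
      Within (openGraph G ω) A n x y := by
  refine ⟨Within.mono le_rfl fun u v _ _ h => ?_, Within.mono le_rfl fun u v hu hv h => ?_⟩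
  · obtain ⟨h, -, hω⟩ := openGraph_adj_restrictTo.1 h
    exact ⟨h, hω⟩
  · obtain ⟨h, hω⟩ := h
    refine openGraph_adj_restrictTo.2 ⟨h, ?_, hω⟩
    simp only [touching, Set.mem_compl_iff, Set.mem_ofPred_eq, Sym2.mem_iff]
    rintro ⟨z, hz, rfl | rfl⟩
    exacts [hu hz, hv hz]

/-- Along an open walk from `x`, a vertex reached in both configurations lies in `A` under either
hypothesis, so the next edge touches `A` and survives the restriction. The disjunction is what makes
the event `cluster = A` invariant in both directions. -/
theorem cluster_restrictTo_touching (ω : Config G) (x : V) {A : Set V}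
    (h : cluster G ω x = A ∨ cluster G (restrictTo (touching G A) ω) x = A) :
    cluster G (restrictTo (touching G A) ω) x = cluster G ω x := by
  have hle : ∀ y, y ∈ cluster G (restrictTo (touching G A) ω) x → y ∈ cluster G ω x := by
    intro y hy
    refine SimpleGraph.Reachable.mono ?_ hy
    intro u v huv
    obtain ⟨h, -, hω⟩ := openGraph_adj_restrictTo.1 huv
    exact ⟨h, hω⟩
  have key : ∀ u v : V, u ∈ A → (openGraph G ω).Adj u v →
      (openGraph G (restrictTo (touching G A) ω)).Adj u v := by
    rintro u v hu ⟨h, hω⟩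
    exact openGraph_adj_restrictTo.2 ⟨h, ⟨u, hu, by simp⟩, hω⟩
  refine Set.Subset.antisymm hle fun y hy => ?_
  obtain ⟨p⟩ := hy
  have aux : ∀ u z : V, (openGraph G ω).Walk u z → (openGraph G ω).Reachable x u →
      (openGraph G (restrictTo (touching G A) ω)).Reachable x u →
      (openGraph G (restrictTo (touching G A) ω)).Reachable x z := by
    intro u z p
    induction p with
    | nil => exact fun _ h => h
    | @cons u v z huv _ ih =>
      intro h1 h2
      refine ih (h1.trans huv.reachable) (h2.trans (key u v ?_ huv).reachable)
      rcases h with rfl | h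
      · exact h1
      · rw [← h]; exact h2
  exact aux x y p (SimpleGraph.Reachable.refl _) (SimpleGraph.Reachable.refl _)

end Graph

/-! ### Expected cluster size when the edges outside `B` are rare. -/

section Graph

variable {V : Type*} {G : SimpleGraph V}

theorem measurableSet_baseCluster_eq [Countable V] (B : Set G.edgeSet) (x : V) (A : Set V) :
    MeasurableSet {ω | cluster G (restrictTo B ω) x = A} :=
  ((measurable_restrictTo B).mono (edgeSigma_le B) le_rfl) (measurableSet_cluster_eq x A)

theorem measurableSet_edgeSigma_baseCluster_eq [Countable V] (B : Set G.edgeSet) (x : V)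
    (A : Set V) :
    MeasurableSet[edgeSigma (B ∩ touching G A)] {ω | cluster G (restrictTo B ω) x = A} := by
  refine measurableSet_edgeSigma_of_restrictTo (measurableSet_baseCluster_eq B x A) fun ω => ?_
  have h : restrictTo B (restrictTo (B ∩ touching G A) ω) =
      restrictTo (touching G A) (restrictTo B ω) := by
    ext e
    by_cases h1 : e ∈ B <;> by_cases h2 : e ∈ touching G A <;> simp [restrictTo, h1, h2]
  simp only [Set.mem_ofPred_eq, h]
  refine ⟨fun h => ?_, fun h => ?_⟩
  · rw [← cluster_restrictTo_touching _ _ (Or.inr h), h]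
  · rw [cluster_restrictTo_touching _ _ (Or.inl h), h]

/-- The event that the edge from `u` to `v` exists, does not belong to `B`, and is open. -/
def openOff (B : Set G.edgeSet) (u v : V) : Set (Config G) :=
  {ω | ∃ h : G.Adj u v, (⟨s(u, v), h⟩ : G.edgeSet) ∉ B ∧ ω ⟨s(u, v), h⟩ = true}

/-- The three events live on disjoint edge sets: edges of `B` touching `A`, the single edge `uv`
(touching `A`, outside `B`), and edges not touching `A`. After factorizing, the constraint of
avoiding `A` is dropped. -/
theorem measure_exit_le [Countable V] (w : G.edgeSet → I) (B : Set G.edgeSet) {q : ℝ≥0∞}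
    (hq : ∀ e ∉ B, ENNReal.ofReal (w e) ≤ q) (x y u v : V) (A : Set V) (hu : u ∈ A) (n : ℕ) :
    bondMeasure G w ({ω | cluster G (restrictTo B ω) x = A} ∩
        (openOff B u v ∩ {ω | Within (openGraph G ω) A n v y})) ≤
      bondMeasure G w {ω | cluster G (restrictTo B ω) x = A} *
        (q * bondMeasure G w {ω | Within (openGraph G ω) ∅ n v y}) := by
  by_cases h : ∃ h : G.Adj u v, (⟨s(u, v), h⟩ : G.edgeSet) ∉ B
  · obtain ⟨h, hB⟩ := h
    set e : G.edgeSet := ⟨s(u, v), h⟩ with he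
    have hO : openOff B u v = {ω | ω e = true} := by
      ext ω; exact ⟨fun ⟨_, _, hω⟩ => hω, fun hω => ⟨h, hB, hω⟩⟩
    have he' : e ∈ touching G A := ⟨u, hu, by simp [he]⟩
    have hO' : MeasurableSet[edgeSigma {e}] {ω : Config G | ω e = true} :=
      measurable_eval_edgeSigma (Set.mem_singleton e) (measurableSet_singleton true)
    have hW : MeasurableSet[edgeSigma (touching G A)ᶜ]
        {ω | Within (openGraph G ω) A n v y} :=
      measurableSet_edgeSigma_of_restrictTo (measurableSet_within A n v y)
        fun ω => within_restrictTo_compl_touching ω A n v y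
    have hdisj : Disjoint {e} (touching G A)ᶜ :=
      Set.disjoint_singleton_left.2 fun h => h he'
    have hdisj' : Disjoint (B ∩ touching G A) ({e} ∪ (touching G A)ᶜ) := by
      rw [Set.disjoint_left]
      rintro f ⟨h1, h2⟩ (h3 | h3)
      · exact hB (h3 ▸ h1)
      · exact h3 h2
    rw [hO, bondMeasure_inter w hdisj' (measurableSet_edgeSigma_baseCluster_eq B x A)
      (@MeasurableSet.inter _ (edgeSigma _) _ _
        (edgeSigma_mono Set.subset_union_left _ hO')
        (edgeSigma_mono Set.subset_union_right _ hW)),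
      bondMeasure_inter w hdisj hO' hW, bondMeasure_open]
    gcongr
    · exact hq e hB
    · exact fun hω => Within.mono (Set.empty_subset A) (fun _ _ _ _ h => h) hω
  · have : openOff B u v = ∅ := by
      ext ω
      simp only [openOff, Set.mem_ofPred_eq, Set.mem_empty_iff_false, iff_false]
      exact fun ⟨h1, h2, _⟩ => h ⟨h1, h2⟩
    simp [this]

/-- Both sides compute a mean cluster size, the left one over finite clusters only; exchange the
sums and use disjointness in `A`. -/
theorem tsum_measure_baseCluster_eq_mul_card_le [Countable V] (w : G.edgeSet → I)
    (B : Set G.edgeSet) (x : V) :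
    ∑' A : Finset V, bondMeasure G w {ω | cluster G (restrictTo B ω) x = A} * A.card ≤
      ∑' u, bondMeasure G w {ω | u ∈ cluster G (restrictTo B ω) x} := by
  classical
  have h1 : ∀ A : Finset V,
      bondMeasure G w {ω | cluster G (restrictTo B ω) x = A} * A.card =
        ∑' u, if u ∈ A then bondMeasure G w {ω | cluster G (restrictTo B ω) x = A} else 0 := by
    intro A
    rw [tsum_eq_sum (s := A) (fun u hu => by simp [hu]), Finset.sum_ite_mem, Finset.inter_self,
      Finset.sum_const, nsmul_eq_mul, mul_comm]
  simp_rw [h1]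
  rw [ENNReal.tsum_comm]
  refine ENNReal.tsum_le_tsum fun u => ?_
  have h2 : ∀ A : Finset V,
      (if u ∈ A then bondMeasure G w {ω | cluster G (restrictTo B ω) x = A} else 0) =
        bondMeasure G w (if u ∈ A then {ω | cluster G (restrictTo B ω) x = A} else ∅) := by
    intro A; split_ifs <;> simp
  simp_rw [h2]
  refine (tsum_meas_le_meas_iUnion_of_disjoint _ (fun A => ?_) ?_).trans (measure_mono ?_)
  · split_ifs
    · exact measurableSet_baseCluster_eq B x A
    · exact MeasurableSet.empty
  · intro A A' hAA'
    refine Set.disjoint_left.2 fun ω h h' => hAA' ?_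
    simp only at h h'
    split_ifs at h h' <;> first | exact h.elim | exact h'.elim | skip
    exact Finset.coe_injective (h.symm.trans h')
  · refine Set.iUnion_subset fun A ω h => ?_
    split_ifs at h with hu
    · rw [Set.mem_ofPred_eq] at h ⊢
      rw [h]; exact hu
    · exact h.elim

theorem tsum_within_succ_le [Countable V] (w : G.edgeSet → I) (B : Set G.edgeSet)
    (N : V → Finset V) {D : ℕ}
    (hN : ∀ u v (h : G.Adj u v), (⟨s(u, v), h⟩ : G.edgeSet) ∉ B → v ∈ N u)
    (hD : ∀ u, (N u).card ≤ D) {q : ℝ≥0∞} (hq : ∀ e ∉ B, ENNReal.ofReal (w e) ≤ q)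
    {X : ℝ≥0∞} (hX : ∀ x, ∑' y, bondMeasure G w {ω | y ∈ cluster G (restrictTo B ω) x} ≤ X)
    (hX' : X ≠ ∞) {n : ℕ} {M : ℝ≥0∞}
    (hM : ∀ x, ∑' y, bondMeasure G w {ω | Within (openGraph G ω) ∅ n x y} ≤ M) (x : V) :
    ∑' y, bondMeasure G w {ω | Within (openGraph G ω) ∅ (n + 1) x y} ≤ X + X * (D * q * M) := by
  set μ := bondMeasure G w with hμ
  -- The cluster formed by `B` has finite mean size, so it is almost surely finite and a sum over
  -- the countably many finite sets `A` suffices.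
  have hfin : μ {ω | (cluster G (restrictTo B ω) x).Infinite} = 0 :=
    ae_finite_setOfPred_mem (ne_top_of_le_ne_top hX' (hX x))
  have hsub : ∀ y, {ω | Within (openGraph G ω) ∅ (n + 1) x y} ⊆
      ({ω | y ∈ cluster G (restrictTo B ω) x} ∪
        {ω | (cluster G (restrictTo B ω) x).Infinite}) ∪
      ⋃ A : Finset V, ⋃ u ∈ A, ⋃ v ∈ N u, ({ω | cluster G (restrictTo B ω) x = A} ∩
        (openOff B u v ∩ {ω | Within (openGraph G ω) (A : Set V) n v y})) := by
    intro y ω hω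
    by_cases hinf : (cluster G (restrictTo B ω) x).Infinite
    · exact Or.inl (Or.inr hinf)
    rw [Set.not_infinite] at hinf
    rcases Within.last_exit (cluster G (restrictTo B ω) x) hω with h | h | ⟨u, hu, v, huv, h⟩
    · exact Or.inl (Or.inl h)
    -- The walk cannot avoid the cluster altogether, since it starts in it.
    · exact absurd (mem_cluster_self _ _) h.notMem
    · right
      obtain ⟨huv, hω⟩ := huv
      -- An exit edge in `B` would put `v` in the cluster.
      have hB : (⟨s(u, v), huv⟩ : G.edgeSet) ∉ B := by
        intro hB
        refine h.notMem (SimpleGraph.Reachable.trans hu (SimpleGraph.Adj.reachable ?_))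
        exact openGraph_adj_restrictTo.2 ⟨huv, hB, hω⟩
      simp only [Set.mem_iUnion]
      refine ⟨hinf.toFinset, u, by simpa using hu, v, hN u v huv hB, ?_, ⟨huv, hB, hω⟩, ?_⟩
      · simp
      · simpa using h
  have hle : ∀ y, μ {ω | Within (openGraph G ω) ∅ (n + 1) x y} ≤
      μ {ω | y ∈ cluster G (restrictTo B ω) x} +
      ∑' A : Finset V, ∑ u ∈ A, ∑ v ∈ N u, μ {ω | cluster G (restrictTo B ω) x = A} *
        (q * μ {ω | Within (openGraph G ω) ∅ n v y}) := by
    intro y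
    refine (measure_mono (hsub y)).trans ((measure_union_le _ _).trans (add_le_add ?_ ?_))
    · exact (measure_union_le _ _).trans (by rw [hfin, add_zero])
    · refine (measure_iUnion_le _).trans (ENNReal.tsum_le_tsum fun A => ?_)
      refine (measure_biUnion_finset_le _ _).trans (Finset.sum_le_sum fun u hu => ?_)
      refine (measure_biUnion_finset_le _ _).trans (Finset.sum_le_sum fun v _ => ?_)
      exact measure_exit_le w B hq x y u v A hu n
  refine (ENNReal.tsum_le_tsum hle).trans ?_
  rw [ENNReal.tsum_add]
  gcongr
  · exact hX x
  · rw [ENNReal.tsum_comm]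
    calc ∑' A : Finset V, ∑' y, ∑ u ∈ A, ∑ v ∈ N u,
          μ {ω | cluster G (restrictTo B ω) x = A} *
            (q * μ {ω | Within (openGraph G ω) ∅ n v y})
        ≤ ∑' A : Finset V, μ {ω | cluster G (restrictTo B ω) x = A} * A.card *
            (D * q * M) := by
          refine ENNReal.tsum_le_tsum fun A => ?_
          rw [Summable.tsum_finsetSum fun _ _ => ENNReal.summable]
          calc ∑ u ∈ A, ∑' y, ∑ v ∈ N u, μ {ω | cluster G (restrictTo B ω) x = A} *
                (q * μ {ω | Within (openGraph G ω) ∅ n v y})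
              ≤ ∑ u ∈ A, μ {ω | cluster G (restrictTo B ω) x = A} * (D * q * M) := by
                refine Finset.sum_le_sum fun u _ => ?_
                rw [Summable.tsum_finsetSum fun _ _ => ENNReal.summable]
                simp_rw [ENNReal.tsum_mul_left]
                rw [← Finset.mul_sum]
                gcongr
                calc ∑ v ∈ N u, q * ∑' y, μ {ω | Within (openGraph G ω) ∅ n v y}
                    ≤ ∑ v ∈ N u, q * M := Finset.sum_le_sum fun v _ => by gcongr; exact hM v
                  _ = (N u).card * (q * M) := by rw [Finset.sum_const, nsmul_eq_mul]
                  _ ≤ D * (q * M) := by gcongr; exact hD u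
                  _ = D * q * M := (mul_assoc _ _ _).symm
            _ = _ := by rw [Finset.sum_const, nsmul_eq_mul]; ring
      _ ≤ X * (D * q * M) := by
          rw [ENNReal.tsum_mul_right]
          gcongr
          exact (tsum_measure_baseCluster_eq_mul_card_le w B x).trans (hX x)

/-- If the edges outside `B` are sufficiently rare, compared with the expected size of the clusters
formed by the edges of `B`, then the expected cluster size is finite. -/
theorem tsum_mem_cluster_le [Countable V] (w : G.edgeSet → I) (B : Set G.edgeSet)
    (N : V → Finset V) {D : ℕ}
    (hN : ∀ u v (h : G.Adj u v), (⟨s(u, v), h⟩ : G.edgeSet) ∉ B → v ∈ N u)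
    (hD : ∀ u, (N u).card ≤ D) {q : ℝ≥0∞} (hq : ∀ e ∉ B, ENNReal.ofReal (w e) ≤ q)
    {X : ℝ≥0∞} (hX : ∀ x, ∑' y, bondMeasure G w {ω | y ∈ cluster G (restrictTo B ω) x} ≤ X)
    (hX' : X ≠ ∞) (hr : D * q * X < 1) (x : V) :
    ∑' y, bondMeasure G w {ω | y ∈ cluster G ω x} ≤ X * (1 - D * q * X)⁻¹ := by
  set r := D * q * X with hrdef
  -- `X * (1 - r)⁻¹` is the fixed point of the recursion `M ↦ X + r * M`, hence a bound preserved by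
  -- induction on `n`.
  have hY : X * (1 - r)⁻¹ = X + X * (D * q * (X * (1 - r)⁻¹)) := by
    have h0 : 1 - r ≠ 0 := (tsub_pos_of_lt hr).ne'
    have h1 : 1 - r ≠ ∞ := ENNReal.sub_ne_top ENNReal.one_ne_top
    have h2 : (1 - r)⁻¹ = 1 + r * (1 - r)⁻¹ := by
      nth_rewrite 2 [← ENNReal.mul_inv_cancel h0 h1]
      rw [← add_mul, tsub_add_cancel_of_le hr.le, one_mul]
    conv_lhs => rw [h2]
    rw [hrdef]; ring
  have hn : ∀ n x, ∑' y, bondMeasure G w {ω | Within (openGraph G ω) ∅ n x y} ≤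
      X * (1 - r)⁻¹ := by
    intro n
    induction n with
    | zero =>
      intro x
      rw [hY]
      refine le_add_right (le_trans (ENNReal.tsum_le_tsum fun y => measure_mono ?_) (hX x))
      rintro ω ⟨rfl, -⟩
      exact mem_cluster_self _ _
    | succ n ih =>
      intro x
      exact (tsum_within_succ_le w B N hN hD hq hX hX' ih x).trans hY.symm.le
  rw [ENNReal.tsum_eq_iSup_sum]
  refine iSup_le fun F => ?_
  have hlim : ∀ y, Tendsto (fun n => bondMeasure G w {ω | Within (openGraph G ω) ∅ n x y}) atTop
      (𝓝 (bondMeasure G w {ω | y ∈ cluster G ω x})) := by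
    intro y
    have : {ω | y ∈ cluster G ω x} = ⋃ n, {ω | Within (openGraph G ω) ∅ n x y} := by
      ext ω; simp [cluster, reachable_iff_exists_within]
    rw [this]
    exact tendsto_measure_iUnion_atTop (monotone_nat_of_le_succ fun n ω h => Within.succ h)
  refine le_of_tendsto' (tendsto_finsetSum F fun y _ => hlim y) fun n => ?_
  exact (ENNReal.sum_le_tsum F).trans (hn n x)

theorem measure_cluster_infinite_eq_zero [Countable V] {w : G.edgeSet → I} {x : V}
    (h : ∑' y, bondMeasure G w {ω | y ∈ cluster G ω x} ≠ ∞) :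
    bondMeasure G w {ω | (cluster G ω x).Infinite} = 0 :=
  ae_finite_setOfPred_mem h

theorem lintegral_encard_cluster [Countable V] (w : G.edgeSet → I) (x : V) :
    ∫⁻ ω, ((cluster G ω x).encard : ℝ≥0∞) ∂(bondMeasure G w) =
      ∑' y, bondMeasure G w {ω | y ∈ cluster G ω x} := by
  have h : ∀ ω, ((cluster G ω x).encard : ℝ≥0∞) =
      ∑' y, {ω | y ∈ cluster G ω x}.indicator (fun _ => (1 : ℝ≥0∞)) ω := by
    intro ω
    rw [Set.encard, ← ENNReal.tsum_one, tsum_subtype (cluster G ω x) fun _ => (1 : ℝ≥0∞)]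
    rfl
  simp_rw [h]
  rw [lintegral_tsum fun y =>
    (measurable_const.indicator (measurableSet_mem_cluster x y)).aemeasurable]
  refine tsum_congr fun y => ?_
  rw [lintegral_indicator_const (measurableSet_mem_cluster x y), one_mul]

end Graph

/-! ### From general graphs to `ℤ^d × ℤ^s`: the lower bound on the critical curve. -/

section Graph

variable {V : Type*} {G : SimpleGraph V}

theorem bondMeasure_forall (w : G.edgeSet → I) (F : Finset G.edgeSet) (b : Bool) :
    bondMeasure G w {ω | ∀ e ∈ F, ω e = b} = ∏ e ∈ F, bondMeasure G w {ω | ω e = b} := by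
  have h : {ω : Config G | ∀ e ∈ F, ω e = b} = Set.pi F fun _ => {b} := by
    ext ω; simp [Set.mem_pi]
  rw [h, bondMeasure, Measure.infinitePi_pi _ fun _ _ => measurableSet_singleton b]
  refine Finset.prod_congr rfl fun e _ => ?_
  exact ((measurePreserving_eval_infinitePi
    (fun e => bernoulliMeasure true false (w e)) e).measure_preimage
      (s := {b}) (measurableSet_singleton b).nullMeasurableSet).symm

theorem chi_eq_tsum (d : ℕ) (p : I) :
    chi d p = ∑' y, isoMeasure d p {ω | y ∈ cluster (lattice d) ω 0} :=
  lintegral_encard_cluster _ _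

theorem one_le_chi (d : ℕ) (p : I) : 1 ≤ chi d p := by
  rw [chi_eq_tsum]
  refine le_trans ?_ (ENNReal.le_tsum 0)
  have : {ω | (0 : Fin d → ℤ) ∈ cluster (lattice d) ω 0} = Set.univ :=
    Set.eq_univ_of_forall fun ω => mem_cluster_self ω 0
  rw [this, measure_univ]

/-- The neighbours of `x` in `ℤ^d` are contained in the box of radius one around `x`. -/
theorem mem_Icc_of_lattice_adj {d : ℕ} {x y : Fin d → ℤ} (h : (lattice d).Adj x y) :
    y ∈ Finset.Icc (x - 1) (x + 1) := by
  have h1 : ∀ i, |x i - y i| ≤ 1 := fun i =>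
    (Finset.single_le_sum (f := fun i => |x i - y i|) (fun j _ => abs_nonneg _)
      (Finset.mem_univ i)).trans (le_of_eq h)
  rw [Finset.mem_Icc]
  constructor <;> intro i <;> have := abs_le.1 (h1 i) <;> simp <;> linarith

theorem card_Icc_box {d : ℕ} (x : Fin d → ℤ) : (Finset.Icc (x - 1) (x + 1)).card = 3 ^ d := by
  rw [Pi.card_Icc]
  simp only [Pi.sub_apply, Pi.add_apply, Pi.one_apply, Int.card_Icc]
  have : ∀ i, (x i + 1 + 1 - (x i - 1)).toNat = 3 := fun i => by
    rw [show x i + 1 + 1 - (x i - 1) = 3 by ring]; rfl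
  simp [this]

/-- The inclusion of `ℤ^d` as the layer through `x` of `ℤ^d × ℤ^s`, with `0` mapped to `x`. -/
def layerHom {d s : ℕ} (x : (Fin d → ℤ) × (Fin s → ℤ)) : lattice d →g prodLattice d s where
  toFun a := (a + x.1, x.2)
  map_rel' {a b} h := by
    refine SimpleGraph.boxProd_adj.2 (Or.inl ⟨?_, rfl⟩)
    simpa [lattice] using h

theorem layerHom_injective {d s : ℕ} (x : (Fin d → ℤ) × (Fin s → ℤ)) :
    Function.Injective (layerHom x) := fun a b h => by
  simpa [layerHom] using h

theorem isBaseEdge_mk {d s : ℕ} {u v : (Fin d → ℤ) × (Fin s → ℤ)}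
    (h : (prodLattice d s).Adj u v) :
    IsBaseEdge (⟨s(u, v), h⟩ : (prodLattice d s).edgeSet) ↔ u.2 = v.2 := by
  simp [IsBaseEdge]

theorem isBaseEdge_layerHom {d s : ℕ} (x : (Fin d → ℤ) × (Fin s → ℤ))
    (e : (lattice d).edgeSet) : IsBaseEdge ((layerHom x).mapEdgeSet e) := by
  obtain ⟨e, he⟩ := e
  induction e using Sym2.ind with
  | _ a b => exact (isBaseEdge_mk ((layerHom x).map_adj he)).2 rfl

/-- `ℤ^d`-edges preserve the `ℤ^s`-component, so such a walk stays in one layer and pulls back to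
`ℤ^d`. -/
theorem exists_reachable_of_base_reachable {d s : ℕ} (x : (Fin d → ℤ) × (Fin s → ℤ))
    (ω : Config (prodLattice d s)) {u v : (Fin d → ℤ) × (Fin s → ℤ)}
    (p : (openGraph _ (restrictTo {e | IsBaseEdge e} ω)).Walk u v) (a : Fin d → ℤ)
    (ha : u = layerHom x a) : ∃ b, v = layerHom x b ∧
      (openGraph (lattice d) fun e => ω ((layerHom x).mapEdgeSet e)).Reachable a b := by
  induction p generalizing a with
  | nil => exact ⟨a, ha, SimpleGraph.Reachable.refl _⟩
  | @cons u v z huv _ ih =>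
    obtain ⟨h, hB, hω⟩ := openGraph_adj_restrictTo.1 huv
    have h2 : u.2 = v.2 := (isBaseEdge_mk h).1 hB
    have hv : v = layerHom x (v.1 - x.1) := by
      refine Prod.ext ?_ ?_
      · simp [layerHom]
      · rw [← h2, ha]; rfl
    have hadj : (lattice d).Adj a (v.1 - x.1) := by
      rcases SimpleGraph.boxProd_adj.1 h with h | h
      · have h := h.1
        rw [ha, hv] at h
        change (lattice d).Adj (a + x.1) (v.1 - x.1 + x.1) at h
        simpa [lattice, sub_sub_eq_add_sub] using h
      · exact absurd h2 h.1.ne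
    obtain ⟨b, hb, hab⟩ := ih _ hv
    have hopen : (openGraph (lattice d) fun e => ω ((layerHom x).mapEdgeSet e)).Adj
        a (v.1 - x.1) := by
      refine ⟨hadj, ?_⟩
      have he : (layerHom x).mapEdgeSet ⟨s(a, v.1 - x.1), hadj⟩ = ⟨s(u, v), h⟩ := by
        refine Subtype.ext ?_
        change s(layerHom x a, layerHom x (v.1 - x.1)) = _
        rw [← ha, ← hv]
      exact (congrArg ω he).trans hω
    exact ⟨b, hb, hopen.reachable.trans hab⟩

theorem tsum_mem_baseCluster_le {d s : ℕ} (p q : I) (x : (Fin d → ℤ) × (Fin s → ℤ)) :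
    ∑' y, anisoMeasure d s p q
      {ω | y ∈ cluster (prodLattice d s) (restrictTo {e | IsBaseEdge e} ω) x} ≤ chi d p := by
  classical
  have hx : x = layerHom x 0 := by simp [layerHom]
  have hsub : ∀ y ω, y ∈ cluster (prodLattice d s) (restrictTo {e | IsBaseEdge e} ω) x →
      ∃ b, y = layerHom x b ∧
        b ∈ cluster (lattice d) (fun e => ω ((layerHom x).mapEdgeSet e)) 0 := by
    intro y ω h
    obtain ⟨p⟩ := h
    exact exists_reachable_of_base_reachable x ω p 0 hx
  -- The configuration seen on the layer through `x` is isotropic percolation with parameter `p`.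
  have hmp : MeasurePreserving (fun (ω : Config (prodLattice d s)) e =>
      ω ((layerHom x).mapEdgeSet e)) (anisoMeasure d s p q) (isoMeasure d p) := by
    have h := measurePreserving_comp_edges
      (fun e : (prodLattice d s).edgeSet => if IsBaseEdge e then p else q)
      (layerHom x).mapEdgeSet
      (SimpleGraph.Hom.mapEdgeSet.injective (layerHom x) (layerHom_injective x))
    have hw : (fun e : (prodLattice d s).edgeSet => if IsBaseEdge e then p else q) ∘
        (layerHom x).mapEdgeSet = fun _ => p := by
      ext e; simp [isBaseEdge_layerHom]
    rw [hw] at h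
    exact h
  rw [← (layerHom_injective x).tsum_eq, chi_eq_tsum]
  · refine ENNReal.tsum_le_tsum fun b => ?_
    rw [← hmp.measure_preimage (measurableSet_mem_cluster 0 b).nullMeasurableSet]
    refine measure_mono fun ω hω => ?_
    obtain ⟨b', hb', h⟩ := hsub _ ω hω
    rw [← layerHom_injective x hb'] at h
    exact h
  · intro y hy
    have : {ω | y ∈ cluster (prodLattice d s) (restrictTo {e | IsBaseEdge e} ω) x}.Nonempty :=
      Set.nonempty_iff_ne_empty.2 fun h => hy (by simp [h])
    obtain ⟨ω, hω⟩ := this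
    obtain ⟨b, hb, -⟩ := hsub y ω hω
    exact ⟨b, hb.symm⟩

/-- `tsum_mem_cluster_le` with `B` the `ℤ^d`-edges. The `ℤ^s`-neighbours are counted crudely by a
box of `3 ^ s` points. -/
theorem thetaAniso_eq_zero {d s : ℕ} {p q : I}
    (h : (3 ^ s : ℕ) * ENNReal.ofReal q * chi d p < 1) (hp : chi d p ≠ ∞) :
    thetaAniso d s p q = 0 := by
  classical
  refine measure_cluster_infinite_eq_zero (ne_top_of_le_ne_top ?_
    (tsum_mem_cluster_le _ {e | IsBaseEdge e}
      (fun u => (Finset.Icc (u.2 - 1) (u.2 + 1)).image fun t => (u.1, t)) (D := 3 ^ s)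
      (fun u v h hB => ?_) (fun u => ?_) (q := ENNReal.ofReal q) (fun e he => ?_)
      (tsum_mem_baseCluster_le p q) hp h 0))
  · refine ENNReal.mul_ne_top hp (ENNReal.inv_ne_top.2 (tsub_pos_of_lt h).ne')
  · have h2 : u.2 ≠ v.2 := fun h2 => hB ((isBaseEdge_mk h).2 h2)
    rcases SimpleGraph.boxProd_adj.1 h with h | h
    · exact absurd h.2 h2
    · exact Finset.mem_image.2 ⟨v.2, mem_Icc_of_lattice_adj h.1, Prod.ext h.2 rfl⟩
  · exact Finset.card_image_le.trans (card_Icc_box _).le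
  · rw [Set.mem_ofPred_eq] at he
    simp [he]

/-- The same criterion with `B = ∅`, whose clusters are single points, so `X = 1`. -/
theorem theta_eq_zero_of_lt {d : ℕ} {p : I} (h : (3 ^ d : ℕ) * ENNReal.ofReal p < 1) :
    theta d p = 0 := by
  have hX : ∀ x, ∑' y, isoMeasure d p {ω | y ∈ cluster (lattice d) (restrictTo ∅ ω) x} ≤ 1 := by
    intro x
    have hc : ∀ ω, cluster (lattice d) (restrictTo ∅ ω) x = {x} := by
      intro ω
      refine Set.Subset.antisymm (fun y hy => ?_)
        (Set.singleton_subset_iff.2 (mem_cluster_self _ x))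
      obtain ⟨p⟩ := hy
      cases p with
      | nil => rfl
      | cons h _ => simp [openGraph, restrictTo] at h
    simp only [hc, Set.mem_singleton_iff]
    rw [tsum_eq_single x (fun y hy => by simp [hy])]
    exact prob_le_one
  refine measure_cluster_infinite_eq_zero (ne_top_of_le_ne_top ?_
    (tsum_mem_cluster_le (fun _ => p) ∅ (fun u => Finset.Icc (u - 1) (u + 1)) (D := 3 ^ d)
      (fun u v h _ => mem_Icc_of_lattice_adj h) (fun u => (card_Icc_box u).le)
      (q := ENNReal.ofReal p) (fun _ _ => le_rfl) hX ENNReal.one_ne_top (by rwa [mul_one]) 0))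
  exact ENNReal.mul_ne_top ENNReal.one_ne_top
    (ENNReal.inv_ne_top.2 (tsub_pos_of_lt (by rwa [mul_one])).ne')

theorem bddAbove_image_coe (S : Set I) : BddAbove ((fun p : I => (p : ℝ)) '' S) :=
  ⟨1, by rintro _ ⟨p, -, rfl⟩; exact p.2.2⟩

theorem le_pc {d : ℕ} {p : I} (h : theta d p = 0) : (p : ℝ) ≤ pc d :=
  le_csSup (bddAbove_image_coe _) ⟨p, h, rfl⟩

theorem le_qc {d s : ℕ} {p q : I} (h : thetaAniso d s p q = 0) : (q : ℝ) ≤ qc d s p :=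
  le_csSup (bddAbove_image_coe _) ⟨q, h, rfl⟩

theorem pc_le_one (d : ℕ) : pc d ≤ 1 :=
  Real.sSup_le (by rintro _ ⟨p, -, rfl⟩; exact p.2.2) zero_le_one

/-- Needed for the filter `belowPc d` to be nontrivial, hence for limits along it to be unique. -/
theorem pc_pos (d : ℕ) : 0 < pc d := by
  have h3 : (1 : ℝ) ≤ 3 ^ d := one_le_pow₀ (by norm_num)
  have hmem : (1 / (2 * 3 ^ d) : ℝ) ∈ I :=
    ⟨by positivity, by rw [div_le_one (by positivity)]; linarith⟩
  have hlt : 0 < (1 / (2 * 3 ^ d) : ℝ) := by positivity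
  refine hlt.trans_le (le_pc (p := ⟨_, hmem⟩) (theta_eq_zero_of_lt ?_))
  rw [← ENNReal.ofReal_natCast, ← ENNReal.ofReal_mul (by positivity), ← ENNReal.ofReal_one]
  rw [ENNReal.ofReal_lt_ofReal_iff one_pos]
  push_cast
  rw [mul_one_div, div_lt_one (by positivity)]
  linarith

/-- The critical curve is at least of the order of the inverse mean cluster size. -/
theorem inv_chi_le_qc (d s : ℕ) {p : I} (hp : chi d p ≠ ∞) :
    1 / (2 * 3 ^ s * (chi d p).toReal) ≤ qc d s p := by
  have h1 : 1 ≤ (chi d p).toReal := by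
    rw [← ENNReal.toReal_one]; exact ENNReal.toReal_mono hp (one_le_chi d p)
  have h3 : (1 : ℝ) ≤ 3 ^ s := one_le_pow₀ (by norm_num)
  have hpos : 0 < 2 * 3 ^ s * (chi d p).toReal := by positivity
  -- The factor `2` makes `3 ^ s * q * χ` equal to `1 / 2`, strictly below `1`.
  have hmem : (1 / (2 * 3 ^ s * (chi d p).toReal) : ℝ) ∈ I :=
    ⟨by positivity, by rw [div_le_one hpos]; nlinarith⟩
  refine le_qc (q := ⟨_, hmem⟩) (thetaAniso_eq_zero ?_ hp)
  obtain ⟨x, hx⟩ : ∃ x, x = chi d p := ⟨_, rfl⟩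
  simp only [← hx] at hp hpos h1 ⊢
  rw [← ENNReal.ofReal_natCast]
  nth_rewrite 2 [← ENNReal.ofReal_toReal hp]
  rw [← ENNReal.ofReal_mul (by positivity), ← ENNReal.ofReal_mul (by positivity),
    ← ENNReal.ofReal_one, ENNReal.ofReal_lt_ofReal_iff one_pos]
  push_cast
  rw [mul_one_div, div_mul_eq_mul_div, div_lt_one hpos]
  nlinarith

/-! ### Percolation on `ℤ`. -/

theorem lattice_one_adj {x y : Fin 1 → ℤ} : (lattice 1).Adj x y ↔ |x 0 - y 0| = 1 := by
  simp [lattice]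

/-- The edge of `ℤ` from `ε * k` to `ε * (k + 1)`, where `ε` is a sign. -/
def rayEdge (ε : ℤˣ) (k : ℕ) : (lattice 1).edgeSet :=
  ⟨s(fun _ => ε * k, fun _ => ε * (k + 1)), lattice_one_adj.2 (by
    rw [show (ε * k - ε * (k + 1) : ℤ) = -ε by ring, abs_neg]
    rcases Int.units_eq_one_or ε with rfl | rfl <;> simp)⟩

theorem rayEdge_injective (ε : ℤˣ) : Function.Injective (rayEdge ε) := by
  intro k l h
  have h := congrArg Subtype.val h
  simp only [rayEdge, Sym2.eq_iff, funext_iff, forall_const] at h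
  rcases Int.units_eq_one_or ε with rfl | rfl <;> simp at h <;> omega

/-- If this edge is closed, no open walk can raise the signed coordinate `ε * x 0` from at most `k`
to above `k`. -/
theorem rayEdge_open_of_mem_cluster {ω : Config (lattice 1)} {ε : ℤˣ} {n k : ℕ} (hk : k < n)
    (h : (fun _ => (ε : ℤ) * n : Fin 1 → ℤ) ∈ cluster (lattice 1) ω 0) : ω (rayEdge ε k) = true := by
  by_contra hω
  have key : ∀ x y : Fin 1 → ℤ, (openGraph (lattice 1) ω).Walk x y → ε * x 0 ≤ k →
      ε * y 0 ≤ k := by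
    intro x y p
    induction p with
    | nil => exact id
    | @cons x z y hxz _ ih =>
      intro hx
      refine ih (not_lt.1 fun hz => hω ?_)
      obtain ⟨hadj, hopen⟩ := hxz
      have habs := lattice_one_adj.1 hadj
      have hx' : x = fun _ => (ε : ℤ) * k := by
        funext i
        rw [Subsingleton.elim i 0]
        rcases Int.units_eq_one_or ε with rfl | rfl <;> simp only [Units.val_one, Units.val_neg] at hx hz ⊢ <;>
          rcases (abs_eq one_pos.le).1 habs with h | h <;> omega
      have hz' : z = fun _ => (ε : ℤ) * (k + 1) := by
        funext i
        rw [Subsingleton.elim i 0]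
        rcases Int.units_eq_one_or ε with rfl | rfl <;> simp only [Units.val_one, Units.val_neg] at hx hz ⊢ <;>
          rcases (abs_eq one_pos.le).1 habs with h | h <;> omega
      rw [← hopen]
      subst hx' hz'
      rfl
  obtain ⟨p⟩ := h
  have := key _ _ p (by simp)
  rcases Int.units_eq_one_or ε with rfl | rfl <;> simp at this <;> omega

theorem measure_mem_cluster_le (p : I) (ε : ℤˣ) (n : ℕ) :
    isoMeasure 1 p {ω | (fun _ => (ε : ℤ) * n : Fin 1 → ℤ) ∈ cluster (lattice 1) ω 0} ≤
      ENNReal.ofReal p ^ n := by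
  calc isoMeasure 1 p {ω | (fun _ => (ε : ℤ) * n : Fin 1 → ℤ) ∈ cluster (lattice 1) ω 0}
      ≤ isoMeasure 1 p {ω | ∀ e ∈ (Finset.range n).map ⟨rayEdge ε, rayEdge_injective ε⟩,
          ω e = true} := by
        refine measure_mono fun ω hω e he => ?_
        obtain ⟨k, hk, rfl⟩ := Finset.mem_map.1 he
        exact rayEdge_open_of_mem_cluster (Finset.mem_range.1 hk) hω
    _ = ENNReal.ofReal p ^ n := by
        rw [isoMeasure, bondMeasure_forall, Finset.prod_map]
        simp [bondMeasure_open]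

theorem chi_one_le {p : I} (hp : (p : ℝ) < 1) : chi 1 p ≤ ENNReal.ofReal (2 / (1 - p)) := by
  have hgeom : ∑' n : ℕ, ENNReal.ofReal p ^ n = ENNReal.ofReal (1 / (1 - p)) := by
    rw [ENNReal.tsum_geometric, ← ENNReal.ofReal_one, ← ENNReal.ofReal_sub _ p.2.1,
      ← ENNReal.ofReal_inv_of_pos (by linarith), one_div]
  rw [chi_eq_tsum, ← (Equiv.funUnique (Fin 1) ℤ).symm.tsum_eq]
  set f : ℤ → ℝ≥0∞ := fun y => isoMeasure 1 p
    {ω | (Equiv.funUnique (Fin 1) ℤ).symm y ∈ cluster (lattice 1) ω 0} with hf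
  have h1 : ∀ n : ℕ, f n ≤ ENNReal.ofReal p ^ n := by
    intro n
    have := measure_mem_cluster_le p 1 n
    simp only [Units.val_one, one_mul] at this
    exact this
  have h2 : ∀ n : ℕ, f (-(n + 1)) ≤ ENNReal.ofReal p ^ n := by
    intro n
    have := measure_mem_cluster_le p (-1) (n + 1)
    simp only [Units.val_neg, Units.val_one, neg_mul, one_mul, Nat.cast_add, Nat.cast_one] at this
    -- The exponent `n + 1` is weakened to `n`, so each half-line contributes `1 / (1 - p)`.
    refine le_trans this (pow_le_pow_of_le_one zero_le ?_ (Nat.le_succ n))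
    exact ENNReal.ofReal_le_one.2 p.2.2
  change ∑' y, f y ≤ _
  rw [(HasSum.of_nat_of_neg_add_one ENNReal.summable.hasSum ENNReal.summable.hasSum).tsum_eq]
  refine (add_le_add (ENNReal.tsum_le_tsum h1) (ENNReal.tsum_le_tsum h2)).trans (le_of_eq ?_)
  rw [hgeom, ← ENNReal.ofReal_add (by simp; linarith) (by simp; linarith)]
  congr 1
  ring

theorem theta_one_eq_zero {p : I} (hp : (p : ℝ) < 1) : theta 1 p = 0 := by
  exact measure_cluster_infinite_eq_zero (ne_top_of_le_ne_top ENNReal.ofReal_ne_top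
    ((chi_eq_tsum 1 p).symm.le.trans (chi_one_le hp)))

theorem pc_one : pc 1 = 1 := by
  refine le_antisymm (pc_le_one 1) (le_of_forall_lt_imp_le_of_dense fun x hx => ?_)
  rcases le_or_gt 0 x with h0 | h0
  · exact le_pc (p := ⟨x, h0, hx.le⟩) (theta_one_eq_zero hx)
  · exact h0.le.trans (pc_pos 1).le

end Graph

/-! ### Deterministic part of the 3 by 3 renormalization. -/

/-- The offsets of the nine sub-blocks of a block. -/
def offsets : Finset (ℕ × ℕ) := Finset.range 3 ×ˢ Finset.range 3

/-- The sub-block of `B` with offset `a`. -/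
def subBlock (B a : ℕ × ℕ) : ℕ × ℕ := (3 * B.1 + a.1, 3 * B.2 + a.2)

/-- A block of level `n + 1` is bad if at least two of its nine sub-blocks of level `n` are bad. -/
def badBlock {Ω : Type*} (bad : ℕ × ℕ → Set Ω) : ℕ → ℕ × ℕ → Set Ω
  | 0, B => bad B
  | n + 1, B => ⋃ a ∈ offsets, ⋃ b ∈ offsets, ⋃ _ : a ≠ b,
      badBlock bad n (subBlock B a) ∩ badBlock bad n (subBlock B b)

/-- The three by three grid with at most one vertex removed is connected. -/
theorem grid_label_eq {C : Type*} {g : ℕ → ℕ → Prop} {F : ℕ → ℕ → C}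
    (hg : ∀ a ∈ offsets, ∀ b ∈ offsets, a ≠ b → g a.1 a.2 ∨ g b.1 b.2)
    (h1 : ∀ i j, g i j → g (i + 1) j → F i j = F (i + 1) j)
    (h2 : ∀ i j, g i j → g i (j + 1) → F i j = F i (j + 1)) :
    ∀ a ∈ offsets, ∀ b ∈ offsets, g a.1 a.2 → g b.1 b.2 → F a.1 a.2 = F b.1 b.2 := by
  have hg' : ∀ i < 3, ∀ j < 3, ∀ i' < 3, ∀ j' < 3, (i ≠ i' ∨ j ≠ j') → g i j ∨ g i' j' := by
    intro i hi j hj i' hi' j' hj' hne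
    refine hg (i, j) (by simp [offsets, hi, hj]) (i', j') (by simp [offsets, hi', hj']) ?_
    rw [Ne, Prod.mk.injEq]; tauto
  have row : ∀ j, g 0 j → g 1 j → g 2 j → ∀ i < 3, F i j = F 0 j := by
    intro j a0 a1 a2 i hi
    have e1 := h1 0 j a0 a1
    have e2 := h1 1 j a1 a2
    interval_cases i
    exacts [rfl, e1.symm, (e1.trans e2).symm]
  have col : ∀ i, g i 0 → g i 1 → g i 2 → ∀ j < 3, F i j = F i 0 := by
    intro i a0 a1 a2 j hj
    have e1 := h2 i 0 a0 a1
    have e2 := h2 i 1 a1 a2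
    interval_cases j
    exacts [rfl, e1.symm, (e1.trans e2).symm]
  by_cases hall : ∀ i < 3, ∀ j < 3, g i j
  · have : ∀ a ∈ offsets, F a.1 a.2 = F 0 0 := by
      intro a ha
      simp only [offsets, Finset.mem_product, Finset.mem_range] at ha
      rw [col a.1 (hall _ ha.1 0 (by simp)) (hall _ ha.1 1 (by simp)) (hall _ ha.1 2 (by simp))
        a.2 ha.2]
      exact row 0 (hall 0 (by simp) 0 (by simp)) (hall 1 (by simp) 0 (by simp))
        (hall 2 (by simp) 0 (by simp)) a.1 ha.1
    exact fun a ha b hb _ _ => (this a ha).trans (this b hb).symm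
  · push Not at hall
    obtain ⟨i, hi, j, hj, hbad⟩ := hall
    have hgood : ∀ i' < 3, ∀ j' < 3, (i ≠ i' ∨ j ≠ j') → g i' j' := fun i' hi' j' hj' hne =>
      (hg' i hi j hj i' hi' j' hj' hne).resolve_left hbad
    -- The lines `i0` and `j0` miss the bad cell. Every good cell has its row or its column free of
    -- the bad cell, and through that line it is joined to `(i0, j0)`.
    obtain ⟨i0, hi0, hii0⟩ : ∃ i0 < 3, i ≠ i0 := by
      by_cases h : i = 0
      · exact ⟨1, by simp, by omega⟩
      · exact ⟨0, by simp, h⟩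
    obtain ⟨j0, hj0, hjj0⟩ : ∃ j0 < 3, j ≠ j0 := by
      by_cases h : j = 0
      · exact ⟨1, by simp, by omega⟩
      · exact ⟨0, by simp, h⟩
    have row' : ∀ y < 3, j ≠ y → ∀ x < 3, F x y = F i0 y := by
      intro y hy hjy x hx
      have := row y (hgood 0 (by simp) y hy (Or.inr hjy)) (hgood 1 (by simp) y hy (Or.inr hjy))
        (hgood 2 (by simp) y hy (Or.inr hjy))
      rw [this x hx, this i0 hi0]
    have col' : ∀ x < 3, i ≠ x → ∀ y < 3, F x y = F x j0 := by
      intro x hx hix y hy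
      have := col x (hgood x hx 0 (by simp) (Or.inl hix)) (hgood x hx 1 (by simp) (Or.inl hix))
        (hgood x hx 2 (by simp) (Or.inl hix))
      rw [this y hy, this j0 hj0]
    have : ∀ a ∈ offsets, g a.1 a.2 → F a.1 a.2 = F i0 j0 := by
      intro a ha hga
      simp only [offsets, Finset.mem_product, Finset.mem_range] at ha
      by_cases hj' : j = a.2
      · have hi' : i ≠ a.1 := by
          rintro rfl
          exact hbad (hj' ▸ hga)
        rw [col' a.1 ha.1 hi' a.2 ha.2, row' j0 hj0 hjj0 a.1 ha.1]
      · rw [row' a.2 ha.2 hj' a.1 ha.1, col' i0 hi0 hii0 a.2 ha.2]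
    exact fun a ha b hb h h' => (this a ha h).trans (this b hb h').symm

/-- Each side spoils at most one of the three facing pairs. -/
theorem exists_facing {g g' : ℕ → Prop} (h : ∀ k < 3, ∀ l < 3, k ≠ l → g k ∨ g l)
    (h' : ∀ k < 3, ∀ l < 3, k ≠ l → g' k ∨ g' l) : ∃ k < 3, g k ∧ g' k := by
  by_contra! hcon
  have c0 := hcon 0 (by simp)
  have c1 := hcon 1 (by simp)
  have c2 := hcon 2 (by simp)
  have e01 := h 0 (by simp) 1 (by simp) (by simp)
  have e02 := h 0 (by simp) 2 (by simp) (by simp)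
  have e12 := h 1 (by simp) 2 (by simp) (by simp)
  have d01 := h' 0 (by simp) 1 (by simp) (by simp)
  have d02 := h' 0 (by simp) 2 (by simp) (by simp)
  have d12 := h' 1 (by simp) 2 (by simp) (by simp)
  tauto

section Labelling

variable {C : Type*} {good : ℕ → ℕ × ℕ → Prop}

theorem exists_good_of_column
    (hgood : ∀ n B, good (n + 1) B → ∀ a ∈ offsets, ∀ b ∈ offsets, a ≠ b →
      good n (subBlock B a) ∨ good n (subBlock B b)) {n : ℕ} {B : ℕ × ℕ} (h : good (n + 1) B) :
    ∃ a ∈ offsets, a.1 = 2 ∧ good n (subBlock B a) := by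
  rcases hgood n B h (2, 0) (by simp [offsets]) (2, 1) (by simp [offsets]) (by simp) with h | h
  exacts [⟨_, by simp [offsets], rfl, h⟩, ⟨_, by simp [offsets], rfl, h⟩]

/-- Adjacent good blocks of any level are connected, and each reaches to its right boundary. -/
theorem exists_labelling
    (hgood : ∀ n B, good (n + 1) B → ∀ a ∈ offsets, ∀ b ∈ offsets, a ≠ b →
      good n (subBlock B a) ∨ good n (subBlock B b))
    (f : ℕ × ℕ → C)
    (h1 : ∀ i j, good 0 (i, j) → good 0 (i + 1, j) → f (i, j) = f (i + 1, j))
    (h2 : ∀ i j, good 0 (i, j) → good 0 (i, j + 1) → f (i, j) = f (i, j + 1)) (n : ℕ) :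
    ∃ F : ℕ × ℕ → C,
      (∀ B, good n B → ∃ v : ℕ × ℕ, 3 ^ n * (B.1 + 1) ≤ v.1 + 1 ∧ f v = F B) ∧
      (∀ i j, good n (i, j) → good n (i + 1, j) → F (i, j) = F (i + 1, j)) ∧
      (∀ i j, good n (i, j) → good n (i, j + 1) → F (i, j) = F (i, j + 1)) ∧
      ((∀ k ≤ n, good k (0, 0)) → F (0, 0) = f (0, 0)) := by
  classical
  induction n with
  | zero => exact ⟨f, fun B _ => ⟨B, by simp, rfl⟩, h1, h2, fun _ => rfl⟩
  | succ n ih =>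
    obtain ⟨F, hF0, hF1, hF2, hF3⟩ := ih
    -- The label of a good block is the common label of its good sub-blocks; bad blocks get an
    -- arbitrary label.
    have hex : ∀ B, ∃ c : C, good (n + 1) B → ∀ a ∈ offsets, good n (subBlock B a) →
        F (subBlock B a) = c := by
      intro B
      by_cases hB : good (n + 1) B
      · obtain ⟨a, ha, -, hga⟩ := exists_good_of_column hgood hB
        refine ⟨F (subBlock B a), fun _ b hb hgb => ?_⟩
        exact grid_label_eq (g := fun i j => good n (subBlock B (i, j)))
          (F := fun i j => F (subBlock B (i, j))) (fun a ha b hb hab => hgood n B hB a ha b hb hab)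
          (fun i j => hF1 _ _) (fun i j => hF2 _ _) b hb a ha hgb hga
      · exact ⟨f B, fun h => absurd h hB⟩
    choose F' hF' using hex
    refine ⟨F', fun B hB => ?_, fun i j h h' => ?_, fun i j h h' => ?_, fun h => ?_⟩
    · obtain ⟨a, ha, ha2, hga⟩ := exists_good_of_column hgood hB
      obtain ⟨v, hv, hfv⟩ := hF0 _ hga
      refine ⟨v, le_trans (le_of_eq ?_) hv, hfv.trans (hF' B hB a ha hga)⟩
      -- The sub-block was chosen in the last column, so its right boundary is that of `B`.
      simp only [subBlock, ha2]; ring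
    · obtain ⟨k, hk, hk1, hk2⟩ : ∃ k < 3, good n (subBlock (i, j) (2, k)) ∧
          good n (subBlock (i + 1, j) (0, k)) := by
        refine exists_facing (g := fun k => good n (subBlock (i, j) (2, k)))
          (g' := fun k => good n (subBlock (i + 1, j) (0, k))) (fun k hk l hl hkl => ?_)
          (fun k hk l hl hkl => ?_)
        · exact hgood n _ h _ (by simp [offsets, hk]) _ (by simp [offsets, hl]) (by simpa using hkl)
        · exact hgood n _ h' _ (by simp [offsets, hk]) _ (by simp [offsets, hl])
            (by simpa using hkl)
      rw [← hF' _ h (2, k) (by simp [offsets, hk]) hk1,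
        ← hF' _ h' (0, k) (by simp [offsets, hk]) hk2]
      exact hF1 _ _ hk1 hk2
    · obtain ⟨k, hk, hk1, hk2⟩ : ∃ k < 3, good n (subBlock (i, j) (k, 2)) ∧
          good n (subBlock (i, j + 1) (k, 0)) := by
        refine exists_facing (g := fun k => good n (subBlock (i, j) (k, 2)))
          (g' := fun k => good n (subBlock (i, j + 1) (k, 0))) (fun k hk l hl hkl => ?_)
          (fun k hk l hl hkl => ?_)
        · exact hgood n _ h _ (by simp [offsets, hk]) _ (by simp [offsets, hl]) (by simpa using hkl)
        · exact hgood n _ h' _ (by simp [offsets, hk]) _ (by simp [offsets, hl])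
            (by simpa using hkl)
      rw [← hF' _ h (k, 2) (by simp [offsets, hk]) hk1,
        ← hF' _ h' (k, 0) (by simp [offsets, hk]) hk2]
      exact hF2 _ _ hk1 hk2
    · rw [← hF' _ (h (n + 1) le_rfl) (0, 0) (by simp [offsets]) (h n (Nat.le_succ n))]
      exact hF3 fun k hk => h k (hk.trans (Nat.le_succ n))

end Labelling

/-! ### Probability that blocks are bad. -/

section Probability

variable {V : Type*} {G : SimpleGraph V} {bad : ℕ × ℕ → Set (Config G)}
  {E : ℕ × ℕ → Set G.edgeSet}

/-- The edges that determine the state of the block `B` of level `n`. -/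
def blockEdges (E : ℕ × ℕ → Set G.edgeSet) (n : ℕ) (B : ℕ × ℕ) : Set G.edgeSet :=
  ⋃ v ∈ {v : ℕ × ℕ | v.1 / 3 ^ n = B.1 ∧ v.2 / 3 ^ n = B.2}, E v

theorem disjoint_blockEdges (hE : Pairwise fun u v => Disjoint (E u) (E v)) (n : ℕ)
    {B B' : ℕ × ℕ} (h : B ≠ B') : Disjoint (blockEdges E n B) (blockEdges E n B') := by
  simp only [blockEdges, Set.disjoint_iUnion_left, Set.disjoint_iUnion_right]
  rintro v ⟨h3, h4⟩ u ⟨h1, h2⟩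
  refine hE ?_
  rintro rfl
  exact h (Prod.ext (h1.symm.trans h3) (h2.symm.trans h4))

theorem blockEdges_subBlock_subset (n : ℕ) (B : ℕ × ℕ) {a : ℕ × ℕ} (ha : a ∈ offsets) :
    blockEdges E n (subBlock B a) ⊆ blockEdges E (n + 1) B := by
  simp only [offsets, Finset.mem_product, Finset.mem_range] at ha
  refine Set.biUnion_subset_biUnion_left ?_
  rintro v ⟨h1, h2⟩
  simp only [subBlock] at h1 h2
  constructor <;> rw [pow_succ, ← Nat.div_div_eq_div_mul] <;> omega

theorem measurableSet_badBlock (hbad : ∀ v, MeasurableSet[edgeSigma (E v)] (bad v)) (n : ℕ)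
    (B : ℕ × ℕ) : MeasurableSet[edgeSigma (blockEdges E n B)] (badBlock bad n B) := by
  induction n generalizing B with
  | zero =>
    refine edgeSigma_mono ?_ _ (hbad B)
    exact Set.subset_biUnion_of_mem (u := E) (x := B) (by simp)
  | succ n ih =>
    refine @Finset.measurableSet_biUnion _ _ (edgeSigma _) _ _ fun a ha => ?_
    refine @Finset.measurableSet_biUnion _ _ (edgeSigma _) _ _ fun b hb => ?_
    refine @MeasurableSet.iUnion _ _ (edgeSigma _) _ _ fun _ => ?_
    exact @MeasurableSet.inter _ (edgeSigma _) _ _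
      (edgeSigma_mono (blockEdges_subBlock_subset n B ha) _ (ih _))
      (edgeSigma_mono (blockEdges_subBlock_subset n B hb) _ (ih _))

theorem subBlock_injective (B : ℕ × ℕ) : Function.Injective (subBlock B) := by
  intro a b h
  simp only [subBlock, Prod.mk.injEq, Nat.add_left_cancel_iff] at h
  exact Prod.ext h.1 h.2

/-- Distinct sub-blocks are independent and there are at most `81` ordered pairs. As `324 = 4 * 81`,
`r ≤ 1 / 324` gives `81 * r ^ 2 ≤ r / 4`. -/
theorem measure_badBlock_le (w : G.edgeSet → I) (hE : Pairwise fun u v => Disjoint (E u) (E v))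
    (hbad : ∀ v, MeasurableSet[edgeSigma (E v)] (bad v))
    (hle : ∀ v, bondMeasure G w (bad v) ≤ ENNReal.ofReal (1 / 324)) (n : ℕ) (B : ℕ × ℕ) :
    bondMeasure G w (badBlock bad n B) ≤ ENNReal.ofReal (1 / 324 * (1 / 4) ^ n) := by
  induction n generalizing B with
  | zero => simpa [badBlock] using hle B
  | succ n ih =>
    set r : ℝ := 1 / 324 * (1 / 4) ^ n with hr
    have hr0 : 0 ≤ r := by positivity
    have hcard : offsets.card = 9 := rfl
    calc bondMeasure G w (badBlock bad (n + 1) B)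
        ≤ ∑ a ∈ offsets, ∑ b ∈ offsets, ENNReal.ofReal (r * r) := by
          refine (measure_biUnion_finset_le _ _).trans (Finset.sum_le_sum fun a _ => ?_)
          refine (measure_biUnion_finset_le _ _).trans (Finset.sum_le_sum fun b _ => ?_)
          by_cases hab : a = b
          · simp [hab]
          · simp only [ne_eq, hab, not_false_eq_true, Set.iUnion_true]
            rw [bondMeasure_inter w
              (disjoint_blockEdges hE n fun h => hab (subBlock_injective B h))
              (measurableSet_badBlock hbad n _) (measurableSet_badBlock hbad n _),
              ENNReal.ofReal_mul hr0]
            exact mul_le_mul' (ih _) (ih _)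
      _ = ENNReal.ofReal (81 * (r * r)) := by
          rw [Finset.sum_const, Finset.sum_const, smul_smul, hcard, nsmul_eq_mul,
            ENNReal.ofReal_mul (by norm_num : (0 : ℝ) ≤ 81)]
          norm_num [-ENNReal.ofReal_mul]
      _ ≤ ENNReal.ofReal (1 / 324 * (1 / 4) ^ (n + 1)) := by
          refine ENNReal.ofReal_le_ofReal ?_
          have h1 : ((1 : ℝ) / 4) ^ n ≤ 1 := pow_le_one₀ (by norm_num) (by norm_num)
          have h2 : r ≤ 1 / 324 := by rw [hr]; linarith
          rw [pow_succ, ← mul_assoc (1 / 324 : ℝ), ← hr]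
          nlinarith

/-- Union bound over levels: the geometric series sums to `1 / 243 < 1`. -/
theorem measure_forall_notMem_badBlock_pos (w : G.edgeSet → I)
    (hE : Pairwise fun u v => Disjoint (E u) (E v))
    (hbad : ∀ v, MeasurableSet[edgeSigma (E v)] (bad v))
    (hle : ∀ v, bondMeasure G w (bad v) ≤ ENNReal.ofReal (1 / 324)) :
    bondMeasure G w {ω | ∀ n, ω ∉ badBlock bad n (0, 0)} ≠ 0 := by
  have h1 : bondMeasure G w (⋃ n, badBlock bad n (0, 0)) < 1 := by
    refine (measure_iUnion_le _).trans_lt (lt_of_le_of_lt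
      (ENNReal.tsum_le_tsum fun n => measure_badBlock_le w hE hbad hle n (0, 0)) ?_)
    rw [← ENNReal.ofReal_tsum_of_nonneg (fun n => by positivity)
      ((summable_geometric_of_lt_one (by norm_num) (by norm_num)).mul_left _), tsum_mul_left,
      tsum_geometric_of_lt_one (by norm_num) (by norm_num), ← ENNReal.ofReal_one,
      ENNReal.ofReal_lt_ofReal_iff one_pos]
    norm_num
  intro h0
  have h2 : (⋃ n, badBlock bad n (0, 0))ᶜ = {ω | ∀ n, ω ∉ badBlock bad n (0, 0)} := by
    ext ω; simp
  have h3 := measure_union_le (μ := bondMeasure G w) (⋃ n, badBlock bad n (0, 0))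
    (⋃ n, badBlock bad n (0, 0))ᶜ
  rw [Set.union_compl_self, measure_univ, h2, h0, add_zero] at h3
  exact absurd h1 h3.not_gt

end Probability

/-! ### Coarse sites in a quadrant of `ℤ × ℤ^(s+1)`: the upper bound on the critical curve. -/

section Geometry

variable {s : ℕ}

/-- The vertex of `ℤ × ℤ^(s+1)` with coordinates `i` and `(j, 0, …, 0)`. -/
def planeVertex (s i j : ℕ) : (Fin 1 → ℤ) × (Fin (s + 1) → ℤ) := (fun _ => i, Pi.single 0 (j : ℤ))

theorem planeVertex_adj_right (s i j : ℕ) :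
    (prodLattice 1 (s + 1)).Adj (planeVertex s i j) (planeVertex s (i + 1) j) :=
  SimpleGraph.boxProd_adj.2 (Or.inl ⟨lattice_one_adj.2 (by simp [planeVertex]), rfl⟩)

theorem planeVertex_adj_up (s i j : ℕ) :
    (prodLattice 1 (s + 1)).Adj (planeVertex s i j) (planeVertex s i (j + 1)) := by
  refine SimpleGraph.boxProd_adj.2 (Or.inr ⟨?_, rfl⟩)
  change ∑ k, |(Pi.single 0 (j : ℤ) : Fin (s + 1) → ℤ) k -
    (Pi.single 0 ((j + 1 : ℕ) : ℤ) : Fin (s + 1) → ℤ) k| = 1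
  rw [Finset.sum_eq_single 0 (fun k _ hk => by simp [hk]) (by simp)]
  simp

/-- The edge from `planeVertex s i j` to `planeVertex s (i + 1) j`. -/
def rightEdge (s i j : ℕ) : (prodLattice 1 (s + 1)).edgeSet :=
  ⟨s(planeVertex s i j, planeVertex s (i + 1) j), planeVertex_adj_right s i j⟩

/-- The edge from `planeVertex s i j` to `planeVertex s i (j + 1)`. -/
def upEdge (s i j : ℕ) : (prodLattice 1 (s + 1)).edgeSet :=
  ⟨s(planeVertex s i j, planeVertex s i (j + 1)), planeVertex_adj_up s i j⟩

theorem planeVertex_inj {i j i' j' : ℕ} (h : planeVertex s i j = planeVertex s i' j') :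
    i = i' ∧ j = j' := by
  have h1 := congrFun (congrArg Prod.fst h) 0
  have h2 := congrFun (congrArg Prod.snd h) 0
  simpa [planeVertex] using And.intro h1 h2

theorem isBaseEdge_rightEdge (s i j : ℕ) : IsBaseEdge (rightEdge s i j) :=
  (isBaseEdge_mk (planeVertex_adj_right s i j)).2 rfl

theorem not_isBaseEdge_upEdge (s i j : ℕ) : ¬ IsBaseEdge (upEdge s i j) := fun h => by
  have h := congrFun ((isBaseEdge_mk (planeVertex_adj_up s i j)).1 h) 0
  simp [planeVertex] at h

theorem rightEdge_inj {i j i' j' : ℕ} (h : rightEdge s i j = rightEdge s i' j') :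
    i = i' ∧ j = j' := by
  rcases Sym2.eq_iff.1 (congrArg Subtype.val h) with h | h
  · exact planeVertex_inj h.1
  · have h1 := planeVertex_inj h.1
    have h2 := planeVertex_inj h.2
    omega

theorem upEdge_inj {i j i' j' : ℕ} (h : upEdge s i j = upEdge s i' j') : i = i' ∧ j = j' := by
  rcases Sym2.eq_iff.1 (congrArg Subtype.val h) with h | h
  · exact planeVertex_inj h.1
  · have h1 := planeVertex_inj h.1
    have h2 := planeVertex_inj h.2
    omega

/-- The event that the coarse site `v`, a horizontal segment of length `L`, is bad: one of its
horizontal edges is closed, or all the edges that lead upwards are closed. -/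
def badSite (s L : ℕ) (v : ℕ × ℕ) : Set (Config (prodLattice 1 (s + 1))) :=
  {ω | (∃ k ∈ Finset.range L, ω (rightEdge s (v.1 * L + k) v.2) = false) ∨
    ∀ k ∈ Finset.range L, ω (upEdge s (v.1 * L + k) v.2) = false}

/-- The edges that determine whether the coarse site `v` is bad. -/
def siteEdges (s L : ℕ) (v : ℕ × ℕ) : Set (prodLattice 1 (s + 1)).edgeSet :=
  {e | ∃ k < L, e = rightEdge s (v.1 * L + k) v.2 ∨ e = upEdge s (v.1 * L + k) v.2}

theorem disjoint_siteEdges (s L : ℕ) :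
    Pairwise fun u v => Disjoint (siteEdges s L u) (siteEdges s L v) := by
  intro u v huv
  refine Set.disjoint_left.2 ?_
  rintro e ⟨k, hk, h⟩ ⟨l, hl, h'⟩
  have key : ¬ (u.1 * L + k = v.1 * L + l ∧ u.2 = v.2) := by
    rintro ⟨h1, h2⟩
    have h3 := congrArg (· / L) h1
    simp only [Nat.add_comm (_ * L), Nat.add_mul_div_right _ _ (by omega : 0 < L),
      Nat.div_eq_of_lt hk, Nat.div_eq_of_lt hl, zero_add] at h3
    exact huv (Prod.ext h3 h2)
  rcases h with rfl | rfl <;> rcases h' with h' | h'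
  · exact key (rightEdge_inj h')
  · exact not_isBaseEdge_upEdge _ _ _ (h' ▸ isBaseEdge_rightEdge _ _ _)
  · exact not_isBaseEdge_upEdge _ _ _ (h' ▸ isBaseEdge_rightEdge _ _ _)
  · exact key (upEdge_inj h')

theorem measurableSet_badSite (s L : ℕ) (v : ℕ × ℕ) :
    MeasurableSet[edgeSigma (siteEdges s L v)] (badSite s L v) := by
  refine measurableSet_edgeSigma_of_restrictTo ?_ fun ω => ?_
  · have hc : ∀ e : (prodLattice 1 (s + 1)).edgeSet,
        MeasurableSet {ω : Config (prodLattice 1 (s + 1)) | ω e = false} := fun e => by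
      have : {ω : Config (prodLattice 1 (s + 1)) | ω e = false} = {ω | ω e = true}ᶜ := by
        ext; simp
      rw [this]
      exact (measurableSet_open e).compl
    have : badSite s L v =
        (⋃ k ∈ Finset.range L, {ω | ω (rightEdge s (v.1 * L + k) v.2) = false}) ∪
        ⋂ k ∈ Finset.range L, {ω | ω (upEdge s (v.1 * L + k) v.2) = false} := by
      ext ω; simp [badSite]
    rw [this]
    exact (Finset.measurableSet_biUnion _ fun k _ => hc _).union
      (Finset.measurableSet_biInter _ fun k _ => hc _)
  · have h1 : ∀ k ∈ Finset.range L, restrictTo (siteEdges s L v) ω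
        (rightEdge s (v.1 * L + k) v.2) = ω (rightEdge s (v.1 * L + k) v.2) := fun k hk =>
      if_pos ⟨k, Finset.mem_range.1 hk, Or.inl rfl⟩
    have h2 : ∀ k ∈ Finset.range L, restrictTo (siteEdges s L v) ω
        (upEdge s (v.1 * L + k) v.2) = ω (upEdge s (v.1 * L + k) v.2) := fun k hk =>
      if_pos ⟨k, Finset.mem_range.1 hk, Or.inr rfl⟩
    refine or_congr (exists_congr fun k => and_congr_right fun hk => ?_)
      (forall₂_congr fun k hk => ?_)
    · rw [h1 k hk]
    · rw [h2 k hk]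

theorem measure_badSite_le (s L : ℕ) (p q : I) (v : ℕ × ℕ) :
    anisoMeasure 1 (s + 1) p q (badSite s L v) ≤
      ENNReal.ofReal (L * (1 - p) + (1 - q) ^ L) := by
  classical
  have hp := p.2.2
  have hq := q.2.2
  have hinj : Function.Injective fun k => upEdge s (v.1 * L + k) v.2 := fun k l h => by
    have := (upEdge_inj h).1
    omega
  have hsub : badSite s L v ⊆
      (⋃ k ∈ Finset.range L, {ω | ω (rightEdge s (v.1 * L + k) v.2) = false}) ∪
      {ω | ∀ e ∈ (Finset.range L).map ⟨_, hinj⟩, ω e = false} := by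
    intro ω hω
    simpa [badSite] using hω
  rw [ENNReal.ofReal_add (mul_nonneg (Nat.cast_nonneg L) (by linarith))
    (pow_nonneg (by linarith) _)]
  refine (measure_mono hsub).trans ((measure_union_le _ _).trans (add_le_add ?_ ?_))
  · refine (measure_biUnion_finset_le _ _).trans ?_
    simp_rw [anisoMeasure, bondMeasure_closed]
    rw [ENNReal.ofReal_mul (Nat.cast_nonneg L), ENNReal.ofReal_natCast]
    simp [isBaseEdge_rightEdge]
  · rw [anisoMeasure, bondMeasure_forall, Finset.prod_map, ENNReal.ofReal_pow (by linarith)]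
    simp [bondMeasure_closed, not_isBaseEdge_upEdge]

variable {L : ℕ} {ω : Config (prodLattice 1 (s + 1))}

theorem reachable_of_notMem_badSite {v : ℕ × ℕ} (h : ω ∉ badSite s L v) {k : ℕ} (hk : k ≤ L) :
    (openGraph _ ω).Reachable (planeVertex s (v.1 * L) v.2)
      (planeVertex s (v.1 * L + k) v.2) := by
  induction k with
  | zero => rfl
  | succ k ih =>
    have hadj : (openGraph _ ω).Adj (planeVertex s (v.1 * L + k) v.2)
        (planeVertex s (v.1 * L + (k + 1)) v.2) := by
      refine ⟨planeVertex_adj_right s _ _, ?_⟩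
      have h' : ω (rightEdge s (v.1 * L + k) v.2) ≠ false := fun h' =>
        h (Or.inl ⟨k, by simpa using hk, h'⟩)
      exact Bool.eq_true_of_not_eq_false h'
    exact (ih (Nat.le_of_succ_le hk)).trans hadj.reachable

theorem reachable_right {i j : ℕ} (h : ω ∉ badSite s L (i, j)) :
    (openGraph _ ω).Reachable (planeVertex s (i * L) j) (planeVertex s ((i + 1) * L) j) := by
  rw [add_mul, one_mul]
  exact reachable_of_notMem_badSite h le_rfl

/-- Follow the lower segment to an open upward edge, cross it, and return along the upper segment.
-/
theorem reachable_up {i j : ℕ} (h : ω ∉ badSite s L (i, j)) (h' : ω ∉ badSite s L (i, j + 1)) :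
    (openGraph _ ω).Reachable (planeVertex s (i * L) j) (planeVertex s (i * L) (j + 1)) := by
  obtain ⟨k, hk, hopen⟩ : ∃ k ∈ Finset.range L, ω (upEdge s (i * L + k) j) = true := by
    by_contra! hcon
    exact h (Or.inr fun k hk => Bool.eq_false_of_not_eq_true (hcon k hk))
  have hk' : k ≤ L := (Finset.mem_range.1 hk).le
  have hadj : (openGraph _ ω).Adj (planeVertex s (i * L + k) j)
      (planeVertex s (i * L + k) (j + 1)) := ⟨planeVertex_adj_up s _ _, hopen⟩
  exact (reachable_of_notMem_badSite h hk').trans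
    (hadj.reachable.trans (reachable_of_notMem_badSite h' hk').symm)

/-- Label a site by the connected component of its left end. If `M` bounds the first coordinate on
the cluster, the good corner block of level `M.toNat + 1` contradicts it, because `n < 3 ^ n`. -/
theorem cluster_infinite_of_notMem_badBlock (hL : 0 < L)
    (h : ∀ n, ω ∉ badBlock (badSite s L) n (0, 0)) :
    (cluster (prodLattice 1 (s + 1)) ω 0).Infinite := by
  intro hfin
  obtain ⟨M, hM⟩ := (hfin.image fun x => x.1 0).bddAbove
  obtain ⟨F, hF0, -, -, hF3⟩ := exists_labelling
    (good := fun n B => ω ∉ badBlock (badSite s L) n B)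
    (fun n B hB a ha b hb hab => by
      by_contra! hcon
      refine hB ?_
      simp only [badBlock, Set.mem_iUnion]
      exact ⟨a, ha, b, hb, hab, hcon⟩)
    (fun v => (openGraph _ ω).connectedComponentMk (planeVertex s (v.1 * L) v.2))
    (fun i j hi _ => SimpleGraph.ConnectedComponent.sound (reachable_right hi))
    (fun i j hi hj => SimpleGraph.ConnectedComponent.sound (reachable_up hi hj)) (M.toNat + 1)
  obtain ⟨v, hv, hfv⟩ := hF0 (0, 0) (h _)
  have hreach := SimpleGraph.ConnectedComponent.exact (hfv.trans (hF3 fun k _ => h k))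
  have h0 : planeVertex s (0 * L) 0 = 0 := by
    refine Prod.ext ?_ ?_
    · funext i; simp [planeVertex]
    · simp [planeVertex]
  rw [h0] at hreach
  have hle : ((v.1 * L : ℕ) : ℤ) ≤ M := hM ⟨_, hreach.symm, rfl⟩
  have h1 : M.toNat + 1 < 3 ^ (M.toNat + 1) := Nat.lt_pow_self (by norm_num)
  have h2 : v.1 ≤ v.1 * L := Nat.le_mul_of_pos_right _ hL
  simp only [zero_add, mul_one] at hv
  omega

theorem thetaAniso_ne_zero (s : ℕ) {p q : I} (hq : 0 < (q : ℝ)) (h : 5184 * (1 - p : ℝ) ≤ q) :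
    thetaAniso 1 (s + 1) p q ≠ 0 := by
  -- `7` is chosen so that `(1 - q) ^ L ≤ exp (-7) ≤ 1 / 648`. Since `L ≤ 8 / q` and `5184 = 8 *
  -- 648`, also `L * (1 - p) ≤ 1 / 648`; together they give `1 / 324`.
  set L := ⌈7 / (q : ℝ)⌉₊ with hLdef
  have hq1 : (q : ℝ) ≤ 1 := q.2.2
  have hL1 : 7 / (q : ℝ) ≤ L := Nat.le_ceil _
  have hL2 : (L : ℝ) ≤ 8 / q := by
    have h1 : (L : ℝ) < 7 / q + 1 := Nat.ceil_lt_add_one (by positivity)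
    have h2 : 1 ≤ 1 / (q : ℝ) := by rwa [le_div_iff₀ hq, one_mul]
    have h3 : 8 / (q : ℝ) = 7 / q + 1 / q := by ring
    linarith
  have hL : 0 < L := Nat.ceil_pos.2 (by positivity)
  have hpow : (1 - q : ℝ) ^ L ≤ 1 / 648 := by
    have h1 : (1 - q : ℝ) ≤ Real.exp (-q) := by linarith [Real.add_one_le_exp (-(q : ℝ))]
    have h2 : (1 - q : ℝ) ^ L ≤ Real.exp (-7) := by
      refine (pow_le_pow_left₀ (by linarith) h1 L).trans ?_
      rw [← Real.exp_nat_mul]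
      refine Real.exp_le_exp.2 ?_
      rw [div_le_iff₀ hq] at hL1
      linarith
    refine h2.trans ?_
    rw [Real.exp_neg, ← one_div]
    refine one_div_le_one_div_of_le (by norm_num) ?_
    have h3 : Real.exp 7 = Real.exp 1 ^ 7 := by rw [← Real.exp_nat_mul]; norm_num
    rw [h3]
    calc (648 : ℝ) ≤ 2.7 ^ 7 := by norm_num
      _ ≤ Real.exp 1 ^ 7 := by
        gcongr
        linarith [Real.exp_one_gt_d9]
  have hlin : (L : ℝ) * (1 - p) ≤ 1 / 648 := by
    calc (L : ℝ) * (1 - p) ≤ 8 / q * (q / 5184) := by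
          gcongr
          · linarith [p.2.2]
          · linarith
      _ = 1 / 648 := by field_simp; norm_num
  have hpos := measure_forall_notMem_badBlock_pos
    (bad := badSite s L) (E := siteEdges s L)
    (open Classical in fun e : (prodLattice 1 (s + 1)).edgeSet => if IsBaseEdge e then p else q)
    (disjoint_siteEdges s L) (measurableSet_badSite s L) (fun v =>
      (measure_badSite_le s L p q v).trans (ENNReal.ofReal_le_ofReal (by linarith)))
  exact fun h0 => hpos (measure_mono_null
    (fun ω hω => cluster_infinite_of_notMem_badBlock hL hω) h0)

theorem qc_one_le {s : ℕ} (hs : 1 ≤ s) {p : I} (hp : (p : ℝ) < 1) :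
    qc 1 s p ≤ 5184 * (1 - p) := by
  obtain ⟨s, rfl⟩ := Nat.exists_eq_add_of_le' hs
  refine Real.sSup_le ?_ (by linarith)
  rintro _ ⟨q, hq, rfl⟩
  by_contra! hlt
  exact thetaAniso_ne_zero s (by linarith) hlt.le hq

end Geometry

/-! ### Logarithmic asymptotics and the exponents. -/

instance instNeBotBelowPc (d : ℕ) : (belowPc d).NeBot := by
  refine comap_neBot_iff_frequently.2 (Eventually.frequently ?_)
  filter_upwards [Ioo_mem_nhdsLT (pc_pos d)] with x hx
  exact ⟨⟨x, hx.1.le, hx.2.le.trans (pc_le_one d)⟩, rfl⟩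

theorem eventually_lt_pc (d : ℕ) : ∀ᶠ p : I in belowPc d, (p : ℝ) < pc d :=
  tendsto_comap.eventually self_mem_nhdsWithin

theorem tendsto_log_dist_pc (d : ℕ) :
    Tendsto (fun p : I => Real.log |(p : ℝ) - pc d|) (belowPc d) atBot := by
  have h : Tendsto (fun p : I => (p : ℝ) - pc d) (belowPc d) (𝓝[≠] 0) := by
    refine tendsto_nhdsWithin_iff.2 ⟨?_, ?_⟩
    · have h1 : Tendsto (fun p : I => (p : ℝ)) (belowPc d) (𝓝 (pc d)) :=
        tendsto_comap.mono_right nhdsWithin_le_nhds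
      simpa using h1.sub_const (pc d)
    · filter_upwards [eventually_lt_pc d] with p hp
      exact (sub_neg.2 hp).ne
  simp_rw [Real.log_abs]
  exact Real.tendsto_log_nhdsNE_zero.comp h

/-- Turns an exponent into the limit of a quotient that does not involve it, so that exponents are
unique and comparable. -/
theorem logEquiv_rpow_iff {d : ℕ} {a : I → ℝ} {ψ : ℝ} (hψ : ψ ≠ 0) :
    LogEquiv (belowPc d) a (fun p => |(p : ℝ) - pc d| ^ ψ) ↔
      Tendsto (fun p => Real.log (a p) / Real.log |(p : ℝ) - pc d|) (belowPc d) (𝓝 ψ) := by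
  have h : (fun p : I => Real.log (a p) / Real.log (|(p : ℝ) - pc d| ^ ψ)) =ᶠ[belowPc d]
      fun p => Real.log (a p) / Real.log |(p : ℝ) - pc d| / ψ := by
    filter_upwards [eventually_lt_pc d] with p hp
    rw [Real.log_rpow (abs_pos.2 (sub_neg.2 hp).ne), div_div, mul_comm]
  rw [LogEquiv, tendsto_congr' h]
  refine ⟨fun h => ?_, fun h => ?_⟩
  · simpa [hψ] using h.mul_const ψ
  · simpa [hψ] using h.div_const ψ

/-- Multiplicative constants vanish: a bounded error divided by a logarithm tending to `-∞` tends to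
`0`. -/
theorem tendsto_log_div_log_of_abs_sub_le {d : ℕ} {a : I → ℝ} {κ M : ℝ}
    (h : ∀ᶠ p in belowPc d, |Real.log (a p) - κ * Real.log (|(p : ℝ) - pc d|)| ≤ M) :
    Tendsto (fun p => Real.log (a p) / Real.log |(p : ℝ) - pc d|) (belowPc d) (𝓝 κ) := by
  have h0 : Tendsto (fun p : I => (Real.log (a p) - κ * Real.log |(p : ℝ) - pc d|) /
      Real.log |(p : ℝ) - pc d|) (belowPc d) (𝓝 0) := by
    have hb : Tendsto (fun p : I => M * |(Real.log |(p : ℝ) - pc d|)⁻¹|) (belowPc d) (𝓝 0) := by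
      simpa using ((tendsto_inv_atBot_zero.comp (tendsto_log_dist_pc d)).abs).const_mul M
    refine squeeze_zero_norm' ?_ hb
    filter_upwards [h] with p hp
    rw [div_eq_mul_inv, norm_mul, Real.norm_eq_abs, Real.norm_eq_abs]
    gcongr
  have h1 := h0.add_const κ
  rw [zero_add] at h1
  refine h1.congr' ?_
  filter_upwards [(tendsto_log_dist_pc d).eventually_lt_atBot 0] with p hp
  rw [sub_div, mul_div_assoc, div_self hp.ne, mul_one, sub_add_cancel]

theorem crossover_le_gamma {d s : ℕ} {γ ψ : ℝ} (hγ : IsGammaExponent d γ)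
    (hψ : IsCrossoverExponent d s ψ) : ψ ≤ γ := by
  have h1 := (logEquiv_rpow_iff (neg_ne_zero.2 hγ.1.ne')).1 hγ.2
  have h2 := (logEquiv_rpow_iff hψ.1.ne').1 hψ.2
  have h3 : Tendsto (fun p : I => -Real.log (2 * 3 ^ s) * (Real.log |(p : ℝ) - pc d|)⁻¹ -
      Real.log (chi d p).toReal / Real.log |(p : ℝ) - pc d|) (belowPc d) (𝓝 γ) := by
    have h4 := ((tendsto_inv_atBot_zero.comp (tendsto_log_dist_pc d)).const_mul
      (-Real.log (2 * 3 ^ s))).sub h1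
    simpa using h4
  refine le_of_tendsto_of_tendsto h2 h3 ?_
  filter_upwards [(tendsto_log_dist_pc d).eventually_lt_atBot 0,
    h1.eventually_lt_const (neg_lt_zero.2 hγ.1)] with p hp hχ
  -- The quotient is close to `-γ < 0`, which rules out the default value `0` and hence `χ = ∞`.
  have hχ0 : (chi d p).toReal ≠ 0 := fun h0 => by simp [h0] at hχ
  have hχ1 : chi d p ≠ ∞ := fun h0 => hχ0 (by simp [h0])
  have hχ2 : 0 < (chi d p).toReal := lt_of_le_of_ne ENNReal.toReal_nonneg hχ0.symm
  rw [← div_eq_mul_inv, ← sub_div]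
  -- The denominator is negative, so the lower bound on `q_c` becomes an upper bound on the
  -- quotient.
  refine div_le_div_of_nonpos_of_le hp.le ?_
  have h5 := Real.log_le_log (by positivity) (inv_chi_le_qc d s hχ1)
  rw [one_div, Real.log_inv, Real.log_mul (by positivity) hχ0] at h5
  linarith

theorem chi_one_ne_top {p : I} (hp : (p : ℝ) < 1) : chi 1 p ≠ ∞ :=
  ne_top_of_le_ne_top ENNReal.ofReal_ne_top (chi_one_le hp)

theorem toReal_chi_one_le {p : I} (hp : (p : ℝ) < 1) : (chi 1 p).toReal ≤ 2 / (1 - p) :=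
  ENNReal.toReal_le_of_le_ofReal (div_nonneg zero_le_two (by linarith)) (chi_one_le hp)

theorem one_le_toReal_chi_one {p : I} (hp : (p : ℝ) < 1) : 1 ≤ (chi 1 p).toReal := by
  rw [← ENNReal.toReal_one]
  exact ENNReal.toReal_mono (chi_one_ne_top hp) (one_le_chi 1 p)

theorem abs_sub_pc_one {p : I} (hp : (p : ℝ) < 1) : |(p : ℝ) - pc 1| = 1 - p := by
  rw [pc_one, abs_sub_comm, abs_of_pos (by linarith)]

theorem tendsto_log_qc_one {s : ℕ} (hs : 1 ≤ s) :
    Tendsto (fun p => Real.log (qc 1 s p) / Real.log |(p : ℝ) - pc 1|) (belowPc 1) (𝓝 1) := by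
  refine tendsto_log_div_log_of_abs_sub_le
    (M := max (Real.log 5184) (Real.log (2 * 3 ^ s * 2))) ?_
  filter_upwards [eventually_lt_pc 1] with p hp
  rw [pc_one] at hp
  rw [abs_sub_pc_one hp, one_mul]
  have hδ : (0 : ℝ) < 1 - p := by linarith
  have h1 := one_le_toReal_chi_one hp
  have hlow := inv_chi_le_qc 1 s (chi_one_ne_top hp)
  have hlow' : (1 - p : ℝ) / (2 * 3 ^ s * 2) ≤ qc 1 s p := by
    refine le_trans ?_ hlow
    rw [div_le_div_iff₀ (by positivity) (by positivity)]
    have := toReal_chi_one_le hp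
    rw [le_div_iff₀ hδ] at this
    have h3 : (0 : ℝ) < 2 * 3 ^ s := by positivity
    nlinarith
  have hlog1 := Real.log_le_log (by positivity) hlow'
  rw [Real.log_div hδ.ne' (by positivity)] at hlog1
  have hlog2 := Real.log_le_log ((by positivity : (0 : ℝ) < _).trans_le hlow') (qc_one_le hs hp)
  rw [Real.log_mul (by norm_num) hδ.ne'] at hlog2
  have hm1 := le_max_left (Real.log 5184) (Real.log (2 * 3 ^ s * 2))
  have hm2 := le_max_right (Real.log 5184) (Real.log (2 * 3 ^ s * 2))
  rw [abs_le]
  constructor <;> linarith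

theorem tendsto_log_chi_one :
    Tendsto (fun p => Real.log (chi 1 p).toReal / Real.log |(p : ℝ) - pc 1|)
      (belowPc 1) (𝓝 (-1)) := by
  refine tendsto_log_div_log_of_abs_sub_le
    (M := max (Real.log 2) (Real.log (2 * 3 ^ 1) + Real.log 5184)) ?_
  filter_upwards [eventually_lt_pc 1] with p hp
  rw [pc_one] at hp
  rw [abs_sub_pc_one hp]
  have hδ : (0 : ℝ) < 1 - p := by linarith
  have h1 := one_le_toReal_chi_one hp
  have hχ : 0 < (chi 1 p).toReal := by linarith
  -- The lower bound on `χ_1` comes from comparing the two bounds on `q_c` for `s = 1`.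
  have hlog1 := Real.log_le_log (by positivity)
    ((inv_chi_le_qc 1 1 (chi_one_ne_top hp)).trans (qc_one_le le_rfl hp))
  rw [one_div, Real.log_inv, Real.log_mul (by norm_num) hχ.ne',
    Real.log_mul (by norm_num) hδ.ne'] at hlog1
  have hlog2 := Real.log_le_log hχ (toReal_chi_one_le hp)
  rw [Real.log_div two_ne_zero hδ.ne'] at hlog2
  have hm1 := le_max_left (Real.log 2) (Real.log (2 * 3 ^ 1) + Real.log 5184)
  have hm2 := le_max_right (Real.log 2) (Real.log (2 * 3 ^ 1) + Real.log 5184)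
  rw [abs_le]
  constructor <;> linarith

theorem isGammaExponent_one_iff (γ : ℝ) : IsGammaExponent 1 γ ↔ γ = 1 := by
  refine ⟨fun h => ?_, ?_⟩
  · have h1 := (logEquiv_rpow_iff (neg_ne_zero.2 h.1.ne')).1 h.2
    exact neg_injective (tendsto_nhds_unique h1 tendsto_log_chi_one)
  · rintro rfl
    exact ⟨one_pos, (logEquiv_rpow_iff (by norm_num)).2 tendsto_log_chi_one⟩

theorem isCrossoverExponent_one_iff {s : ℕ} (hs : 1 ≤ s) (ψ : ℝ) :
    IsCrossoverExponent 1 s ψ ↔ ψ = 1 := by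
  refine ⟨fun h => ?_, ?_⟩
  · exact tendsto_nhds_unique ((logEquiv_rpow_iff h.1.ne').1 h.2) (tendsto_log_qc_one hs)
  · rintro rfl
    exact ⟨one_pos, (logEquiv_rpow_iff one_ne_zero).2 (tendsto_log_qc_one hs)⟩

end Percolation

end

theorem corollary2 :
    ((∀ γ : ℝ, Percolation.IsGammaExponent 1 γ ↔ γ = 1) ∧
      (∀ s : ℕ, 1 ≤ s → ∀ ψ : ℝ, Percolation.IsCrossoverExponent 1 s ψ ↔ ψ = 1) ∧
      Percolation.CrossoverConjecture 1) ∧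
    (∀ d s : ℕ, 1 ≤ d → 1 ≤ s → ∀ γ ψ : ℝ,
      Percolation.IsGammaExponent d γ → Percolation.IsCrossoverExponent d s ψ → ψ ≤ γ) := by
  refine ⟨⟨Percolation.isGammaExponent_one_iff, fun s hs ψ =>
    Percolation.isCrossoverExponent_one_iff hs ψ, 1, fun s hs =>
      (Percolation.isCrossoverExponent_one_iff hs 1).2 rfl, fun γ hγ =>
        ((Percolation.isGammaExponent_one_iff γ).1 hγ).symm⟩, ?_⟩
  exact fun d s _ _ γ ψ hγ hψ => Percolation.crossover_le_gamma hγ hψ
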